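/- Let $d\ge 1$. Let $\Omega\subset\mathbb R^d$ be an open set immersed in a finite mesh $\mathcal T$ of closed hypercubes of side $h>0$ taken from a uniform axis-aligned grid: $\Omega\subset\Omega_{\mathcal T}:=\bigcup_{T\in\mathcal T}T$, and $T\cap\Omega\ne\emptyset$ for all $T\in\mathcal T$. Let $\mathcal T_\Gamma=\{T\in\mathcal T: T\cap\partial\Omega\neq\emptyset\}$ be the set of cut elements, and let $\mathcal F_\Gamma$ be the set of common $(d-1)$-dimensional faces of two elements of $\mathcal T$ at least one of which is in $\mathcal T_\Gamma$. For $p\ge1$ let $V_h^p$ be the space of continuous functions on $\Omega_{\mathcal T}$ whose restriction to every $T\in\mathcal T$ is a polynomial of degree at most $p$ in each variable. For weights $w_1,\dots,w_p>0$ and a penalty parameter $\gamma_M>0$ let $$M(u,v)=(u,v)_{L^2(\Omega)}+\gamma_M\sum_{F\in\mathcal F_\Gamma}\sum_{k=1}^p w_k\frac{h^{2k+1}}{(2k+1)(k!)^2}\int_F[\partial_n^ku][\partial_n^kv],$$ where $[\cdot]$ denotes the jump over $F$ and $\partial_n^k$ the $k$-th derivative in the direction of the face normal. For a basis $(\phi_i)$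 of $V_h^p$ (for example the Lagrange basis with Gauss–Lobatto nodes) let $\mathcal M_{ij}=M(\phi_i,\phi_j)$ be the stabilized mass matrix and $\mathcal M^*_{ij}=(\phi_i,\phi_j)_{L^2(\Omega_{\mathcal T})}$ the mass matrix on the background mesh. Let $\kappa(A)=\|A\|_2\|A^{-1}\|_2$ denote the spectral condition number (for a symmetric positive definite matrix, $\lambda_{\max}/\lambda_{\min}$). Suppose that the geometry is resolved by the mesh in the sense that, for an integer $N_J\ge 0$, from every cut element one can reach an element of $\mathcal T\setminus\mathcal T_\Gamma$ by at most $N_J$ jumps, each from a cut element to an element of $\mathcal T$ that shares a face with it. Let $C_1(p)$ be a constant, depending only on $p$ and $d$, such that $\|q\|_{L^2(T_1)}^2\le C_1(p)\|q\|_{L^2(T_2)}^2$ for all grid cells $T_1,T_2$ (of any size) that share a face and all polynomials $q$ of degree at most $p$ in each variable; such a constant exists. Put $$L(w)=C_1(p)+\sum_{k=1}^p\frac1{w_k},\qquad G(w)=\sum_{k=1}^p w_k\frac{p^{4k+2}}{(2k+1)(k!)^2}.$$ Then $\mathcal M$ and $\mathcal M^*$ are positive definite and $$\kappa(\mathcal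 M)\le C_M(w)\,\kappa(\mathcal M^*),\qquad C_M(w)=C_l\,L(w)^{N_J}\,(1+C_g\,G(w)),$$ where the constant $C_g>0$ depends only on $d$ and $\gamma_M$, and the constant $C_l>0$ only on $d$, $\gamma_M$ and $N_J$. In particular neither depends on $h$, $p$, $w$, the choice of basis, or on how the boundary of $\Omega$ cuts the mesh. -/

import Mathlib

open MeasureTheory

noncomputable section

namespace CutFEM

/-- The closed grid cell with multi-index `c` of the axis-aligned grid of mesh size `h` through the
point `o`: the hypercube `∏ᵢ [oᵢ + h cᵢ, oᵢ + h (cᵢ + 1)]`. -/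
def gridCell {d : ℕ} (o : Fin d → ℝ) (h : ℝ) (c : Fin d → ℤ) : Set (Fin d → ℝ) :=
  {x | ∀ i, o i + h * (c i : ℝ) ≤ x i ∧ x i ≤ o i + h * ((c i : ℝ) + 1)}

/-- The multi-index of the neighbour of the cell `c` in the positive `j`-th direction. -/
def nextCell {d : ℕ} (c : Fin d → ℤ) (j : Fin d) : Fin d → ℤ :=
  Function.update c j (c j + 1)

/-- Two cells share a `(d-1)`-dimensional face. -/
def ShareFace {d : ℕ} (c c' : Fin d → ℤ) : Prop :=
  ∃ j, c' = nextCell c j ∨ c = nextCell c' j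

/-- An open set `Ω ⊆ ℝ^d` immersed in a (finite) mesh of hypercubes of side `h`, aligned with the
coordinate axes: the cells cover `Ω`, and every cell has some part inside `Ω`. -/
structure ImmersedDomain (d : ℕ) where
  /-- a grid point -/
  o : Fin d → ℝ
  /-- the mesh size -/
  h : ℝ
  h_pos : 0 < h
  /-- the multi-indices of the elements of the mesh -/
  cells : Finset (Fin d → ℤ)
  /-- the domain -/
  Ω : Set (Fin d → ℝ)
  isOpen_Ω : IsOpen Ω
  Ω_subset : Ω ⊆ ⋃ c ∈ cells, gridCell o h c
  cell_inter_Ω : ∀ c ∈ cells, (gridCell o h c ∩ Ω).Nonempty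

namespace ImmersedDomain

variable {d : ℕ} (D : ImmersedDomain d)

/-- The element with multi-index `c`. -/
def cell (c : Fin d → ℤ) : Set (Fin d → ℝ) := gridCell D.o D.h c

/-- The domain `Ω_𝒯` covered by the mesh. -/
def meshDomain : Set (Fin d → ℝ) := ⋃ c ∈ D.cells, D.cell c

open Classical in
/-- The cut elements `𝒯_Γ`: the elements intersected by the boundary of `Ω`. -/
def cutCells : Finset (Fin d → ℤ) :=
  D.cells.filter fun c => (D.cell c ∩ frontier D.Ω).Nonempty

open Classical in
/-- The stabilized faces `ℱ_Γ`. The pair `(c, j)` stands for the common face of the cells `c` and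
`nextCell c j`; both have to be elements of the mesh, and at least one of them has to be cut. -/
def cutFaces : Finset ((Fin d → ℤ) × Fin d) :=
  (D.cells ×ˢ Finset.univ).filter fun F =>
    nextCell F.1 F.2 ∈ D.cells ∧ (F.1 ∈ D.cutCells ∨ nextCell F.1 F.2 ∈ D.cutCells)

/-- From every cut element one reaches an uncut element of the mesh in at most `N` jumps, each jump
leading from a cut element to an element of the mesh sharing a face with it. -/
def ResolvedWithin (N : ℕ) : Prop :=
  ∀ c ∈ D.cutCells, ∃ n ≤ N, ∃ T : ℕ → (Fin d → ℤ),
    T 0 = c ∧ (∀ i < n, T i ∈ D.cutCells ∧ ShareFace (T i) (T (i + 1))) ∧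
      T n ∈ D.cells ∧ T n ∉ D.cutCells

/-- The continuous finite element space `V_h^p`: continuous functions on `Ω_𝒯` whose restriction to
each element is a polynomial of degree at most `p` in each variable. A function on `Ω_𝒯` is
identified with its extension by zero to `ℝ^d`. -/
def feSpace (p : ℕ) : Submodule ℝ ((Fin d → ℝ) → ℝ) where
  carrier := {v | ContinuousOn v D.meshDomain ∧ (∀ x, x ∉ D.meshDomain → v x = 0) ∧
    ∀ c ∈ D.cells, ∃ q : MvPolynomial (Fin d) ℝ, (∀ i, q.degreeOf i ≤ p) ∧
      ∀ x ∈ D.cell c, v x = MvPolynomial.eval x q}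
  zero_mem' := ⟨continuousOn_const, fun _ _ => rfl, fun _ _ => ⟨0, by simp, by simp⟩⟩
  add_mem' := by
    rintro u v ⟨hu, hu0, huq⟩ ⟨hv, hv0, hvq⟩
    refine ⟨hu.add hv, fun x hx => by simp [hu0 x hx, hv0 x hx], fun c hc => ?_⟩
    obtain ⟨q, hq, hqu⟩ := huq c hc
    obtain ⟨r, hr, hrv⟩ := hvq c hc
    refine ⟨q + r, fun i => (MvPolynomial.degreeOf_add_le i q r).trans (max_le (hq i) (hr i)),
      fun x hx => by simp [hqu x hx, hrv x hx]⟩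
  smul_mem' := by
    rintro a v ⟨hv, hv0, hvq⟩
    refine ⟨hv.const_smul a, fun x hx => by simp [hv0 x hx], fun c hc => ?_⟩
    obtain ⟨q, hq, hqv⟩ := hvq c hc
    refine ⟨MvPolynomial.C a * q,
      fun i => (MvPolynomial.degreeOf_C_mul_le q i a).trans (hq i),
      fun x hx => by simp [hqv x hx]⟩

/-- The `k`-th derivative in direction `x_j` at `x` of the restriction of `v` to the element `c`
(one-sided if `x` lies on a face of the element that is orthogonal to `x_j`). -/
def cellDeriv (c : Fin d → ℤ) (j : Fin d) (k : ℕ) (v : (Fin d → ℝ) → ℝ) (x : Fin d → ℝ) : ℝ :=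
  iteratedDerivWithin k (fun t => v (Function.update x j t))
    (Set.Icc (D.o j + D.h * (c j : ℝ)) (D.o j + D.h * ((c j : ℝ) + 1))) (x j)

/-- The jump `[∂_n^k v]` over the face between `c` and `nextCell c j`, where the normal `n` is the
`j`-th unit vector. -/
def jump (c : Fin d → ℤ) (j : Fin d) (k : ℕ) (v : (Fin d → ℝ) → ℝ) (x : Fin d → ℝ) : ℝ :=
  D.cellDeriv (nextCell c j) j k v x - D.cellDeriv c j k v x

/-- The integral of `f` over the common face of `c` and `nextCell c j`, with respect to
`(d-1)`-dimensional Lebesgue measure in the coordinates `x_i`, `i ≠ j`. -/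
def faceIntegral (c : Fin d → ℤ) (j : Fin d) (f : (Fin d → ℝ) → ℝ) : ℝ :=
  ∫ y in {y : {i : Fin d // i ≠ j} → ℝ |
      ∀ i : {i : Fin d // i ≠ j}, D.o i.1 + D.h * (c i.1 : ℝ) ≤ y i ∧
        y i ≤ D.o i.1 + D.h * ((c i.1 : ℝ) + 1)},
    f (fun i => if hi : i = j then D.o j + D.h * ((c j : ℝ) + 1) else y ⟨i, hi⟩)

/-- The `L²` scalar product over `X ⊆ ℝ^d`. -/
def l2Inner (X : Set (Fin d → ℝ)) (u v : (Fin d → ℝ) → ℝ) : ℝ := ∫ x in X, u x * v x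

/-- The weighted jump stabilization `j(u, v)`. -/
def stab (p : ℕ) (w : ℕ → ℝ) (u v : (Fin d → ℝ) → ℝ) : ℝ :=
  ∑ F ∈ D.cutFaces, ∑ k ∈ Finset.Icc 1 p,
    w k * (D.h ^ (2 * k + 1) / ((2 * k + 1) * (k.factorial : ℝ) ^ 2)) *
      D.faceIntegral F.1 F.2 (fun x => D.jump F.1 F.2 k u x * D.jump F.1 F.2 k v x)

/-- The stabilized bilinear form `M(u, v) = (u, v)_Ω + γ j(u, v)`. -/
def massForm (p : ℕ) (w : ℕ → ℝ) (γ : ℝ) (u v : (Fin d → ℝ) → ℝ) : ℝ :=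
  l2Inner D.Ω u v + γ * D.stab p w u v

/-- The stabilized mass matrix `M(φ_i, φ_j)` in the basis `φ`. -/
def massMatrix {p : ℕ} {ι : Type*} (φ : Module.Basis ι ℝ (D.feSpace p)) (w : ℕ → ℝ) (γ : ℝ) :
    Matrix ι ι ℝ :=
  Matrix.of fun i j => D.massForm p w γ (φ i : (Fin d → ℝ) → ℝ) (φ j : (Fin d → ℝ) → ℝ)

/-- The mass matrix `(φ_i, φ_j)_{Ω_𝒯}` of the whole background mesh in the basis `φ`. -/
def meshMassMatrix {p : ℕ} {ι : Type*} (φ : Module.Basis ι ℝ (D.feSpace p)) : Matrix ι ι ℝ :=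
  Matrix.of fun i j =>
    l2Inner D.meshDomain (φ i : (Fin d → ℝ) → ℝ) (φ j : (Fin d → ℝ) → ℝ)

end ImmersedDomain

/-- The spectral condition number `‖A‖₂ ‖A⁻¹‖₂` of an invertible real matrix. -/
def condNumber {ι : Type*} [Fintype ι] [DecidableEq ι] (A : Matrix ι ι ℝ) : ℝ :=
  ‖Matrix.toEuclideanCLM (n := ι) (𝕜 := ℝ) A‖ * ‖Matrix.toEuclideanCLM (n := ι) (𝕜 := ℝ) A⁻¹‖

/-- `C` is a constant in the equivalence of the squared `L²` norms on two neighbouring elements, for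
polynomials of degree at most `p` in each of the `d` variables, uniformly in the mesh size. -/
def IsNeighbourConst (d p : ℕ) (C : ℝ) : Prop :=
  ∀ (o : Fin d → ℝ) (h : ℝ), 0 < h → ∀ c c' : Fin d → ℤ, ShareFace c c' →
    ∀ q : MvPolynomial (Fin d) ℝ, (∀ i, q.degreeOf i ≤ p) →
      ∫ x in gridCell o h c, (MvPolynomial.eval x q) ^ 2 ≤
        C * ∫ x in gridCell o h c', (MvPolynomial.eval x q) ^ 2

/-- `L(w) = C₁ + ∑_{k=1}^p 1 / w_k`. -/
def weightL (C₁ : ℝ) (p : ℕ) (w : ℕ → ℝ) : ℝ := C₁ + ∑ k ∈ Finset.Icc 1 p, 1 / w k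

/-- `G(w) = ∑_{k=1}^p w_k p^{4k+2} / ((2k+1) (k!)²)`. -/
def weightG (p : ℕ) (w : ℕ → ℝ) : ℝ :=
  ∑ k ∈ Finset.Icc 1 p, w k * ((p : ℝ) ^ (4 * k + 2) / ((2 * k + 1) * (k.factorial : ℝ) ^ 2))

end CutFEM

end

/-!
The two mass matrices are the Gram matrices of two scalar products on the same space, so it suffices
to compare the quadratic forms `M(v, v)` and `‖v‖²` over the background mesh: spectrally equivalent
forms have comparable largest and smallest eigenvalues.

From above, the jump terms are bounded by inverse trace estimates with an explicit dependence on
`p`. On a line they follow by writing a polynomial in the Legendre basis and bounding the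
derivatives of the Legendre polynomials at the end points.

From below, one controls the norm on a cut cell by the norm on a neighbour. The polynomials on the
two cells agree on the common face, and by Taylor's formula their difference is determined by the
jumps of the normal derivatives. The Cauchy–Schwarz inequality weighted by `1 / C₁` and the `w k`
turns this into an estimate with the factor `L(w)`. Iterating it along the paths from cut cells to
uncut cells, which lie in `Ω`, gives the power `L(w) ^ N_J`.
-/

noncomputable section

namespace CutFEM

section LegendreExpansion

open Polynomial

theorem integral_derivative_mul_eval (F G : ℝ[X]) (a b : ℝ) :
    ∫ x in a..b, (derivative F).eval x * G.eval x =
      F.eval b * G.eval b - F.eval a * G.eval a -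
        ∫ x in a..b, F.eval x * (derivative G).eval x := by
  rw [intervalIntegral.integral_mul_deriv_eq_deriv_mul (fun x _ => F.hasDerivAt x)
    (fun x _ => G.hasDerivAt x) ((derivative F).continuous.intervalIntegrable _ _)
    ((derivative G).continuous.intervalIntegrable _ _)]
  ring

theorem integral_iterate_derivative_mul_eval {n m : ℕ} (hm : m ≤ n) (G : ℝ[X]) :
    ∫ x in (0 : ℝ)..1, (derivative^[m] ((X * (1 - X) : ℝ[X]) ^ n)).eval x * G.eval x =
      (-1) ^ m * ∫ x in (0 : ℝ)..1,
        ((X * (1 - X) : ℝ[X]) ^ n).eval x * (derivative^[m] G).eval x := by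
  induction m generalizing G with
  | zero => simp
  | succ m ih =>
    obtain ⟨r, hr⟩ : (X * (1 - X) : ℝ[X]) ∣ derivative^[m] ((X * (1 - X) : ℝ[X]) ^ n) :=
      (dvd_pow_self _ (Nat.sub_ne_zero_of_lt hm)).trans
        (pow_sub_dvd_iterate_derivative_of_pow_dvd m dvd_rfl)
    have h0 : (derivative^[m] ((X * (1 - X) : ℝ[X]) ^ n)).eval 0 = 0 := by simp [hr]
    have h1 : (derivative^[m] ((X * (1 - X) : ℝ[X]) ^ n)).eval 1 = 0 := by simp [hr]
    rw [Function.iterate_succ_apply', integral_derivative_mul_eval, ih (by lia) (derivative G),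
      Function.iterate_succ_apply, h0, h1]
    ring

theorem integral_pow_mul_one_sub_pow (a b : ℕ) :
    ∫ x in (0 : ℝ)..1, x ^ a * (1 - x) ^ b =
      (a.factorial : ℝ) * b.factorial / (a + b + 1).factorial := by
  induction b generalizing a with
  | zero =>
    simp [Nat.factorial_succ]
    field_simp
  | succ b ih =>
    have h := integral_derivative_mul_eval (X ^ (a + 1)) ((1 - X) ^ (b + 1)) 0 1
    have hl : ∀ x : ℝ, (derivative (X ^ (a + 1) : ℝ[X])).eval x * ((1 - X) ^ (b + 1) : ℝ[X]).eval x
        = (a + 1) * (x ^ a * (1 - x) ^ (b + 1)) := fun x => by simp; ring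
    have hr : ∀ x : ℝ, (X ^ (a + 1) : ℝ[X]).eval x * (derivative ((1 - X) ^ (b + 1) : ℝ[X])).eval x
        = (-(b + 1)) * (x ^ (a + 1) * (1 - x) ^ b) := fun x => by
      simp [derivative_pow]; ring
    simp only [hl, hr, intervalIntegral.integral_const_mul, ih] at h
    rw [show a + 1 + b + 1 = a + (b + 1) + 1 by ring] at h
    apply mul_left_cancel₀ (show (a + 1 : ℝ) ≠ 0 by positivity)
    rw [h]
    simp [Nat.factorial_succ]
    ring

/-- The shifted Legendre polynomial with real coefficients, the orthogonal polynomial of degree `n`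
on `[0, 1]` normalized by the value `1` at `0`. -/
def legendre (n : ℕ) : ℝ[X] := (shiftedLegendre n).map (Int.castRingHom ℝ)

theorem coeff_legendre (n k : ℕ) :
    (legendre n).coeff k = (-1) ^ k * n.choose k * (n + k).choose n := by
  simp [legendre, coeff_map, coeff_shiftedLegendre]

theorem degree_legendre (n : ℕ) : (legendre n).degree = n := by
  rw [legendre, degree_map_eq_of_injective (RingHom.injective_int _), degree_shiftedLegendre]

theorem factorial_mul_legendre (n : ℕ) :
    C (n.factorial : ℝ) * legendre n = derivative^[n] ((X * (1 - X) : ℝ[X]) ^ n) := by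
  have h := congrArg (Polynomial.map (Int.castRingHom ℝ)) (factorial_mul_shiftedLegendre_eq n)
  rw [← mul_pow, Polynomial.map_mul, ← iterate_derivative_map] at h
  simpa [legendre] using h

theorem factorial_mul_integral_legendre_mul (n : ℕ) (G : ℝ[X]) :
    (n.factorial : ℝ) * ∫ x in (0 : ℝ)..1, (legendre n).eval x * G.eval x =
      (-1) ^ n * ∫ x in (0 : ℝ)..1,
        ((X * (1 - X) : ℝ[X]) ^ n).eval x * (derivative^[n] G).eval x := by
  rw [← integral_iterate_derivative_mul_eval le_rfl, ← factorial_mul_legendre,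
    ← intervalIntegral.integral_const_mul]
  simp [mul_assoc]

theorem integral_legendre_mul_eq_zero {n : ℕ} {G : ℝ[X]} (hG : G.degree < n) :
    ∫ x in (0 : ℝ)..1, (legendre n).eval x * G.eval x = 0 := by
  have h := factorial_mul_integral_legendre_mul n G
  rw [iterate_derivative_eq_zero_of_degree_lt hG] at h
  simpa [n.factorial_ne_zero] using h

theorem iterate_derivative_legendre (n : ℕ) :
    derivative^[n] (legendre n) = C ((-1) ^ n * (n.factorial * n.centralBinom : ℝ)) := by
  have hdeg : (derivative^[n] (legendre n)).natDegree = 0 :=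
    Nat.le_zero.1 <| (natDegree_iterate_derivative _ _).trans <| by
      rw [natDegree_eq_of_degree_eq_some (degree_legendre n), Nat.sub_self]
  rw [eq_C_of_natDegree_eq_zero hdeg, coeff_iterate_derivative, coeff_legendre]
  simp [Nat.descFactorial_self, Nat.centralBinom_eq_two_mul_choose, two_mul]
  ring

theorem integral_legendre_mul_self (n : ℕ) :
    ∫ x in (0 : ℝ)..1, (legendre n).eval x * (legendre n).eval x = 1 / (2 * n + 1) := by
  have hn : (n.factorial : ℝ) ≠ 0 := by positivity
  have hfac : ((n + n + 1).factorial : ℝ) =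
      (2 * n + 1) * (n.centralBinom * n.factorial * n.factorial) := by
    have h := Nat.choose_mul_factorial_mul_factorial (show n ≤ 2 * n by lia)
    rw [two_mul n, Nat.add_sub_cancel, ← two_mul, ← Nat.centralBinom_eq_two_mul_choose] at h
    rw [Nat.factorial_succ, ← two_mul, ← h]
    push_cast
    ring
  have h := factorial_mul_integral_legendre_mul n (legendre n)
  simp only [iterate_derivative_legendre, eval_C, intervalIntegral.integral_mul_const, eval_pow,
    eval_mul, eval_X, eval_sub, eval_one, mul_pow, integral_pow_mul_one_sub_pow, hfac] at h
  apply mul_left_cancel₀ hn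
  rw [h]
  have hc : (n.centralBinom : ℝ) ≠ 0 := by exact_mod_cast n.centralBinom_ne_zero
  have hs : ((-1 : ℝ) ^ n) ^ 2 = 1 := by simp [← pow_mul, mul_comm n]
  field_simp
  exact hs

theorem integral_legendre_mul_legendre_of_ne {m n : ℕ} (h : m ≠ n) :
    ∫ x in (0 : ℝ)..1, (legendre m).eval x * (legendre n).eval x = 0 := by
  rcases h.lt_or_gt with h | h
  · simp_rw [mul_comm ((legendre m).eval _)]
    exact integral_legendre_mul_eq_zero (by simpa [degree_legendre] using h)
  · exact integral_legendre_mul_eq_zero (by simpa [degree_legendre] using h)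

theorem exists_eq_sum_legendre {p : ℕ} {q : ℝ[X]} (hq : q.natDegree ≤ p) :
    ∃ a : ℕ → ℝ, q = ∑ n ∈ Finset.range (p + 1), C (a n) * legendre n := by
  let S : Sequence ℝ := ⟨legendre, degree_legendre⟩
  have hmem : q ∈ Submodule.span ℝ (legendre '' Set.Iic p) :=
    (S.span_degreeLE fun n _ => (leadingCoeff_ne_zero.2 (S.ne_zero n)).isUnit) ▸
      mem_degreeLE.2 (degree_le_of_natDegree_le hq)
  obtain ⟨a, ha, rfl⟩ := (Finsupp.mem_span_image_iff_linearCombination ℝ).1 hmem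
  have hsupp : a.support ⊆ Finset.range (p + 1) := fun n hn =>
    Finset.mem_range_succ_iff.2 ((Finsupp.mem_supported ℝ a).1 ha hn)
  refine ⟨a, ?_⟩
  rw [Finsupp.linearCombination_apply, Finsupp.sum_of_support_subset a hsupp _ (by simp)]
  simp only [smul_eq_C_mul]

theorem integral_sum_legendre_sq (s : Finset ℕ) (a : ℕ → ℝ) :
    ∫ x in (0 : ℝ)..1, (∑ n ∈ s, C (a n) * legendre n).eval x ^ 2 =
      ∑ n ∈ s, a n ^ 2 / (2 * n + 1) := by
  have hexp : ∀ x : ℝ, (∑ n ∈ s, C (a n) * legendre n).eval x ^ 2 =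
      ∑ m ∈ s, ∑ n ∈ s, a m * a n * ((legendre m).eval x * (legendre n).eval x) := fun x => by
    simp only [eval_finsetSum, eval_mul, eval_C, sq, Finset.sum_mul_sum, mul_mul_mul_comm]
  have hint : ∀ m n, IntervalIntegrable
      (fun x => a m * a n * ((legendre m).eval x * (legendre n).eval x)) volume 0 1 := fun m n =>
    (continuous_const.mul
      ((legendre m).continuous.mul (legendre n).continuous)).intervalIntegrable _ _
  have hsum : ∀ m, IntervalIntegrable
      (fun x => ∑ n ∈ s, a m * a n * ((legendre m).eval x * (legendre n).eval x)) volume 0 1 :=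
    fun m => (continuous_finsetSum s fun n _ => continuous_const.mul
      ((legendre m).continuous.mul (legendre n).continuous)).intervalIntegrable _ _
  simp_rw [hexp]
  rw [intervalIntegral.integral_finsetSum fun m _ => hsum m]
  refine Finset.sum_congr rfl fun m hm => ?_
  rw [intervalIntegral.integral_finsetSum fun n _ => hint m n, Finset.sum_eq_single_of_mem m hm,
    intervalIntegral.integral_const_mul, integral_legendre_mul_self]
  · ring
  · intro n _ hn
    rw [intervalIntegral.integral_const_mul, integral_legendre_mul_legendre_of_ne hn.symm, mul_zero]

theorem coeff_sq_le_integral {p : ℕ} {q : ℝ[X]} (hq : q.natDegree ≤ p) (k : ℕ) :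
    q.coeff k ^ 2 ≤ (∑ n ∈ Finset.range (p + 1), (2 * n + 1) * (legendre n).coeff k ^ 2) *
      ∫ x in (0 : ℝ)..1, q.eval x ^ 2 := by
  obtain ⟨a, rfl⟩ := exists_eq_sum_legendre hq
  rw [integral_sum_legendre_sq, finsetSum_coeff]
  refine Finset.sum_sq_le_sum_mul_sum_of_sq_le_mul _ (fun n _ => by positivity)
    (fun n _ => by positivity) fun n _ => le_of_eq ?_
  rw [coeff_C_mul]
  field_simp

end LegendreExpansion

section InverseEstimates

open Polynomial

theorem descFactorial_mul_ascFactorial_le (n k : ℕ) :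
    n.descFactorial k * (n + 1).ascFactorial k ≤ (n * (n + 1)) ^ k := by
  induction k with
  | zero => simp
  | succ k ih =>
    have hstep : (n - k) * (n + 1 + k) ≤ n * (n + 1) := by
      obtain h | ⟨m, rfl⟩ := (le_total n k).imp_right Nat.exists_eq_add_of_le
      · simp [Nat.sub_eq_zero_of_le h]
      · rw [Nat.add_sub_cancel_left]
        nlinarith
    calc n.descFactorial (k + 1) * (n + 1).ascFactorial (k + 1)
        = n.descFactorial k * (n + 1).ascFactorial k * ((n - k) * (n + 1 + k)) := by
          rw [Nat.descFactorial_succ, Nat.ascFactorial_succ]; ring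
      _ ≤ (n * (n + 1)) ^ k * (n * (n + 1)) := Nat.mul_le_mul ih hstep

theorem factorial_mul_choose_mul_choose_le (n k : ℕ) :
    k.factorial * (n.choose k * (n + k).choose n) ≤ (n * (n + 1)) ^ k := by
  have hchoose : (n + k).choose n ≤ (n + 1).ascFactorial k := by
    rw [Nat.ascFactorial_eq_factorial_mul_choose, Nat.choose_symm_add]
    exact Nat.le_mul_of_pos_left _ k.factorial_pos
  calc k.factorial * (n.choose k * (n + k).choose n)
      = n.descFactorial k * (n + k).choose n := by
        rw [← mul_assoc, ← Nat.descFactorial_eq_factorial_mul_choose]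
    _ ≤ n.descFactorial k * (n + 1).ascFactorial k := Nat.mul_le_mul_left _ hchoose
    _ ≤ (n * (n + 1)) ^ k := descFactorial_mul_ascFactorial_le n k

theorem mul_add_one_pow_le {p k : ℕ} (hp : 1 ≤ p) (hk : k ≤ p) :
    ((p : ℝ) * (p + 1)) ^ k ≤ 3 * (p : ℝ) ^ (2 * k) := by
  have hexp : (1 / (p : ℝ) + 1) ^ k ≤ 3 := calc
    (1 / (p : ℝ) + 1) ^ k ≤ (1 / (p : ℝ) + 1) ^ p := pow_le_pow_right₀ (by simp) hk
    _ ≤ Real.exp (1 / p) ^ p := pow_le_pow_left₀ (by positivity) (Real.add_one_le_exp _) _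
    _ = Real.exp 1 := by rw [← Real.exp_nat_mul]; congr 1; field_simp
    _ ≤ 3 := Real.exp_one_lt_three.le
  calc ((p : ℝ) * (p + 1)) ^ k = (1 / (p : ℝ) + 1) ^ k * (p : ℝ) ^ (2 * k) := by
        rw [pow_mul, ← mul_pow]; congr 1; field_simp; ring
    _ ≤ 3 * (p : ℝ) ^ (2 * k) := by gcongr

theorem factorial_sq_mul_coeff_legendre_sq_le {n p k : ℕ} (hp : 1 ≤ p) (hn : n ≤ p) (hk : k ≤ p) :
    (k.factorial : ℝ) ^ 2 * (legendre n).coeff k ^ 2 ≤ 9 * (p : ℝ) ^ (4 * k) := by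
  have hle : (k.factorial : ℝ) * (n.choose k * (n + k).choose n) ≤ 3 * (p : ℝ) ^ (2 * k) := calc
    (k.factorial : ℝ) * (n.choose k * (n + k).choose n) ≤ ((n : ℝ) * (n + 1)) ^ k := by
      exact_mod_cast factorial_mul_choose_mul_choose_le n k
    _ ≤ ((p : ℝ) * (p + 1)) ^ k := by gcongr
    _ ≤ 3 * (p : ℝ) ^ (2 * k) := mul_add_one_pow_le hp hk
  have hs : ((-1 : ℝ) ^ k) ^ 2 = 1 := by simp [← pow_mul, mul_comm k]
  calc (k.factorial : ℝ) ^ 2 * (legendre n).coeff k ^ 2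
      = (k.factorial * (n.choose k * (n + k).choose n) : ℝ) ^ 2 := by
        rw [coeff_legendre, mul_pow, mul_pow, hs]; ring
    _ ≤ (3 * (p : ℝ) ^ (2 * k)) ^ 2 := by gcongr
    _ = 9 * (p : ℝ) ^ (4 * k) := by ring

theorem sum_range_two_mul_add_one (n : ℕ) : ∑ i ∈ Finset.range n, (2 * (i : ℝ) + 1) = n ^ 2 := by
  induction n with
  | zero => simp
  | succ n ih => rw [Finset.sum_range_succ, ih]; push_cast; ring

theorem factorial_mul_coeff_sq_le_integral {p k : ℕ} {q : ℝ[X]} (hp : 1 ≤ p) (hk : k ≤ p)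
    (hq : q.natDegree ≤ p) :
    ((k.factorial : ℝ) * q.coeff k) ^ 2 ≤ 36 * (p : ℝ) ^ (4 * k + 2) *
      ∫ x in (0 : ℝ)..1, q.eval x ^ 2 := by
  have hp1 : (1 : ℝ) ≤ p := by exact_mod_cast hp
  have hI : 0 ≤ ∫ x in (0 : ℝ)..1, q.eval x ^ 2 :=
    intervalIntegral.integral_nonneg zero_le_one fun x _ => sq_nonneg _
  have hkernel : (k.factorial : ℝ) ^ 2 *
      ∑ n ∈ Finset.range (p + 1), (2 * n + 1) * (legendre n).coeff k ^ 2 ≤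
        36 * (p : ℝ) ^ (4 * k + 2) := calc
    _ = ∑ n ∈ Finset.range (p + 1),
          (2 * (n : ℝ) + 1) * ((k.factorial : ℝ) ^ 2 * (legendre n).coeff k ^ 2) := by
      rw [Finset.mul_sum]; exact Finset.sum_congr rfl fun n _ => by ring
    _ ≤ ∑ n ∈ Finset.range (p + 1), (2 * (n : ℝ) + 1) * (9 * (p : ℝ) ^ (4 * k)) := by
      refine Finset.sum_le_sum fun n hn => mul_le_mul_of_nonneg_left ?_ (by positivity)
      exact factorial_sq_mul_coeff_legendre_sq_le hp (Finset.mem_range_succ_iff.1 hn) hk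
    _ = 9 * (p : ℝ) ^ (4 * k) * (p + 1) ^ 2 := by
      rw [← Finset.sum_mul, sum_range_two_mul_add_one]; push_cast; ring
    _ ≤ 9 * (p : ℝ) ^ (4 * k) * (2 * p) ^ 2 := by gcongr; linarith
    _ = 36 * (p : ℝ) ^ (4 * k + 2) := by ring
  calc ((k.factorial : ℝ) * q.coeff k) ^ 2 = (k.factorial : ℝ) ^ 2 * q.coeff k ^ 2 := mul_pow ..
    _ ≤ (k.factorial : ℝ) ^ 2 * (_ * ∫ x in (0 : ℝ)..1, q.eval x ^ 2) := by
      gcongr; exact coeff_sq_le_integral hq k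
    _ ≤ _ := by rw [← mul_assoc]; gcongr

theorem exists_eval_sq_le_integral (p : ℕ) : ∃ K : ℝ, ∀ q : ℝ[X], q.natDegree ≤ p →
    ∀ s : ℝ, |s| ≤ 1 → q.eval s ^ 2 ≤ K * ∫ x in (0 : ℝ)..1, q.eval x ^ 2 := by
  refine ⟨(p + 1) * ∑ k ∈ Finset.range (p + 1),
    ∑ n ∈ Finset.range (p + 1), (2 * n + 1) * (legendre n).coeff k ^ 2, fun q hq s hs => ?_⟩
  calc q.eval s ^ 2 = (∑ k ∈ Finset.range (p + 1), q.coeff k * s ^ k) ^ 2 := by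
        rw [eval_eq_sum_range' (Nat.lt_succ_of_le hq)]
    _ ≤ (p + 1) * ∑ k ∈ Finset.range (p + 1), (q.coeff k * s ^ k) ^ 2 := by
        simpa using sq_sum_le_card_mul_sum_sq (s := Finset.range (p + 1))
          (f := fun k => q.coeff k * s ^ k)
    _ ≤ (p + 1) * ∑ k ∈ Finset.range (p + 1), q.coeff k ^ 2 := by
        refine mul_le_mul_of_nonneg_left (Finset.sum_le_sum fun k _ => ?_) (by positivity)
        rw [mul_pow, ← pow_mul, mul_comm k, pow_mul]
        exact mul_le_of_le_one_right (sq_nonneg _)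
          (pow_le_one₀ (sq_nonneg s) ((sq_le_one_iff_abs_le_one s).2 hs))
    _ ≤ _ := by
        rw [mul_assoc, Finset.sum_mul]
        gcongr with k
        exact coeff_sq_le_integral hq k

/-- The polynomial `s ↦ P (a + b s)`: the pullback of `P` from the interval with end points `a` and
`a + b` to the unit interval. A negative `b` is allowed, so that both sides of `a` are covered. -/
def affineComp (P : ℝ[X]) (a b : ℝ) : ℝ[X] := P.comp (C b * X + C a)

theorem eval_affineComp (P : ℝ[X]) (a b s : ℝ) :
    (affineComp P a b).eval s = P.eval (a + b * s) := by
  simp [affineComp, add_comm]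

theorem natDegree_affineComp_le (P : ℝ[X]) (a b : ℝ) :
    (affineComp P a b).natDegree ≤ P.natDegree :=
  natDegree_comp_le.trans ((Nat.mul_le_mul_left _ natDegree_linear_le).trans (mul_one _).le)

theorem iterate_derivative_affineComp (P : ℝ[X]) (a b : ℝ) (k : ℕ) :
    derivative^[k] (affineComp P a b) = C (b ^ k) * affineComp (derivative^[k] P) a b := by
  induction k with
  | zero => simp
  | succ k ih =>
    rw [Function.iterate_succ_apply', ih, Function.iterate_succ_apply' _ k P, derivative_C_mul]
    simp [affineComp, derivative_comp, pow_succ]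
    ring

theorem factorial_mul_coeff_affineComp (P : ℝ[X]) (a b : ℝ) (k : ℕ) :
    (k.factorial : ℝ) * (affineComp P a b).coeff k = b ^ k * (derivative^[k] P).eval a := by
  have h : (derivative^[k] (affineComp P a b)).coeff 0 =
      (k.factorial : ℝ) * (affineComp P a b).coeff k := by
    simp [coeff_iterate_derivative, Nat.descFactorial_self]
  rw [← h, coeff_zero_eq_eval_zero, iterate_derivative_affineComp]
  simp [eval_affineComp]

theorem sq_iterate_derivative_le_integral {p k : ℕ} {P : ℝ[X]} (hp : 1 ≤ p) (hk : k ≤ p)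
    (hP : P.natDegree ≤ p) (a b : ℝ) :
    b ^ (2 * k) * (derivative^[k] P).eval a ^ 2 ≤ 36 * (p : ℝ) ^ (4 * k + 2) *
      ∫ s in (0 : ℝ)..1, P.eval (a + b * s) ^ 2 := by
  have h := factorial_mul_coeff_sq_le_integral hp hk ((natDegree_affineComp_le P a b).trans hP)
  simpa only [eval_affineComp, factorial_mul_coeff_affineComp, mul_pow, ← pow_mul,
    mul_comm k 2] using h

theorem exists_integral_reflect_le (p : ℕ) : ∃ K : ℝ, ∀ P : ℝ[X], P.natDegree ≤ p → ∀ a b : ℝ,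
    ∫ s in (0 : ℝ)..1, P.eval (a - b * s) ^ 2 ≤ K * ∫ s in (0 : ℝ)..1, P.eval (a + b * s) ^ 2 := by
  obtain ⟨K, hK⟩ := exists_eval_sq_le_integral p
  refine ⟨K, fun P hP a b => ?_⟩
  have hpt : ∀ s ∈ Set.Icc (0 : ℝ) 1,
      P.eval (a - b * s) ^ 2 ≤ K * ∫ s in (0 : ℝ)..1, P.eval (a + b * s) ^ 2 := fun s hs => by
    simpa [eval_affineComp, ← sub_eq_add_neg] using
      hK (affineComp P a b) ((natDegree_affineComp_le P a b).trans hP) (-s)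
        (by rw [abs_neg, abs_of_nonneg hs.1]; exact hs.2)
  have hcont : Continuous fun s => P.eval (a - b * s) ^ 2 := by have := P.continuous; fun_prop
  simpa using intervalIntegral.integral_mono_on zero_le_one (hcont.intervalIntegrable 0 1)
    (intervalIntegrable_const (μ := volume)) hpt

end InverseEstimates

section WeightedTaylor

open Polynomial

theorem add_sum_sq_le {ι : Type*} (s : Finset ι) {C x : ℝ} {w y : ι → ℝ} (hC : 0 < C)
    (hw : ∀ i ∈ s, 0 < w i) :
    (x + ∑ i ∈ s, y i) ^ 2 ≤
      (C + ∑ i ∈ s, 1 / w i) * (C⁻¹ * x ^ 2 + ∑ i ∈ s, w i * y i ^ 2) := by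
  have h := Finset.sum_sq_le_sum_mul_sum_of_sq_le_mul s.insertNone (r := fun i => i.elim x y)
    (f := fun i => i.elim C fun i => 1 / w i)
    (g := fun i => i.elim (C⁻¹ * x ^ 2) fun i => w i * y i ^ 2)
    (Finset.forall_mem_insertNone.2 ⟨hC.le, fun i hi => (one_div_pos.2 (hw i hi)).le⟩)
    (Finset.forall_mem_insertNone.2 ⟨mul_nonneg (inv_nonneg.2 hC.le) (sq_nonneg x),
      fun i hi => mul_nonneg (hw i hi).le (sq_nonneg _)⟩)
    (Finset.forall_mem_insertNone.2 ⟨by simp [hC.ne'], fun i hi => by simp [(hw i hi).ne']⟩)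
  simpa [Finset.sum_insertNone] using h

theorem eval_add_mul_eq_sum {p : ℕ} {P : ℝ[X]} (hP : P.natDegree ≤ p) {a : ℝ}
    (h0 : P.eval a = 0) (b s : ℝ) :
    P.eval (a + b * s) = ∑ k ∈ Finset.Icc 1 p,
      b ^ k / k.factorial * (derivative^[k] P).eval a * s ^ k := by
  have hcoeff : ∀ k, (affineComp P a b).coeff k =
      b ^ k / k.factorial * (derivative^[k] P).eval a := fun k => by
    have hk : (k.factorial : ℝ) ≠ 0 := by positivity
    rw [div_mul_eq_mul_div, eq_div_iff hk, mul_comm, factorial_mul_coeff_affineComp]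
  have hdeg := (natDegree_affineComp_le P a b).trans hP
  rw [← eval_affineComp, eval_eq_sum_range' (Nat.lt_succ_of_le hdeg), Finset.range_eq_Ico,
    Finset.sum_eq_sum_Ico_succ_bot p.succ_pos]
  simp [hcoeff, h0, Finset.Ico_add_one_right_eq_Icc]

theorem integral_sum_mul_pow_sq {s : Finset ℕ} (w c : ℕ → ℝ) :
    ∫ x in (0 : ℝ)..1, ∑ k ∈ s, w k * (c k * x ^ k) ^ 2 =
      ∑ k ∈ s, w k * (c k ^ 2 / (2 * k + 1)) := by
  rw [intervalIntegral.integral_finsetSum fun k _ =>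
    Continuous.intervalIntegrable (by fun_prop) _ _]
  refine Finset.sum_congr rfl fun k _ => ?_
  simp [mul_pow, ← pow_mul, mul_comm k 2, div_eq_mul_inv]

theorem integral_sq_le_weightL_mul {p : ℕ} {C : ℝ} (hC : 0 < C) {w : ℕ → ℝ}
    (hw : ∀ k ∈ Finset.Icc 1 p, 0 < w k) {P Q : ℝ[X]} (hP : P.natDegree ≤ p)
    (hQ : Q.natDegree ≤ p) {a : ℝ} (h0 : P.eval a = Q.eval a) (b : ℝ) :
    ∫ s in (0 : ℝ)..1, P.eval (a + b * s) ^ 2 ≤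
      weightL C p w * (C⁻¹ * (∫ s in (0 : ℝ)..1, Q.eval (a + b * s) ^ 2) +
        ∑ k ∈ Finset.Icc 1 p, w k * (b ^ (2 * k) / ((2 * k + 1) * (k.factorial : ℝ) ^ 2)) *
          ((derivative^[k] P).eval a - (derivative^[k] Q).eval a) ^ 2) := by
  set c : ℕ → ℝ := fun k => b ^ k / k.factorial * (derivative^[k] (P - Q)).eval a with hc
  have hTaylor : ∀ s : ℝ, P.eval (a + b * s) =
      Q.eval (a + b * s) + ∑ k ∈ Finset.Icc 1 p, c k * s ^ k := fun s => by
    rw [← eval_add_mul_eq_sum ((natDegree_sub_le P Q).trans (max_le hP hQ)) (by simp [h0]),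
      eval_sub, add_sub_cancel]
  have := P.continuous
  have := Q.continuous
  calc ∫ s in (0 : ℝ)..1, P.eval (a + b * s) ^ 2
      ≤ ∫ s in (0 : ℝ)..1, weightL C p w * (C⁻¹ * Q.eval (a + b * s) ^ 2 +
          ∑ k ∈ Finset.Icc 1 p, w k * (c k * s ^ k) ^ 2) :=
        intervalIntegral.integral_mono_on zero_le_one
          (Continuous.intervalIntegrable (by fun_prop) _ _)
          (Continuous.intervalIntegrable (by fun_prop) _ _)
          fun s _ => (hTaylor s).symm ▸ add_sum_sq_le _ hC hw
    _ = weightL C p w * (C⁻¹ * (∫ s in (0 : ℝ)..1, Q.eval (a + b * s) ^ 2) +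
          ∑ k ∈ Finset.Icc 1 p, w k * (c k ^ 2 / (2 * k + 1))) := by
        rw [intervalIntegral.integral_const_mul, intervalIntegral.integral_add,
          intervalIntegral.integral_const_mul, integral_sum_mul_pow_sq]
        all_goals exact Continuous.intervalIntegrable (by fun_prop) _ _
    _ = _ := by
        congr! 3 with k
        simp only [hc, iterate_derivative_sub, eval_sub]
        field_simp
        ring

theorem iteratedDerivWithin_eval {P : ℝ[X]} {s : Set ℝ} (hs : UniqueDiffOn ℝ s) (k : ℕ) :
    Set.EqOn (iteratedDerivWithin k (fun t => P.eval t) s)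
      (fun t => (derivative^[k] P).eval t) s := by
  induction k with
  | zero => intro x _; simp
  | succ k ih =>
    intro x hx
    rw [iteratedDerivWithin_succ, derivWithin_congr ih (ih hx), Function.iterate_succ_apply']
    exact ((derivative^[k] P).hasDerivAt x).hasDerivWithinAt.derivWithin (hs x hx)

end WeightedTaylor

section Glue

variable {ι α : Type*} [DecidableEq ι]

/-- The point with `j`-th coordinate `t` and the other coordinates given by `y`: the parametrization
of the hyperplane `x_j = t` that underlies `ImmersedDomain.faceIntegral`. -/
def glue (j : ι) (t : α) (y : {i : ι // i ≠ j} → α) : ι → α :=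
  fun i => if hi : i = j then t else y ⟨i, hi⟩

theorem glue_self (j : ι) (t : α) (y : {i : ι // i ≠ j} → α) : glue j t y j = t :=
  dif_pos rfl

theorem glue_coe {j : ι} (t : α) (y : {i : ι // i ≠ j} → α) (i : {i : ι // i ≠ j}) :
    glue j t y i = y i :=
  dif_neg i.2

theorem update_glue (j : ι) (s t : α) (y : {i : ι // i ≠ j} → α) :
    Function.update (glue j t y) j s = glue j s y := by
  ext i
  rcases eq_or_ne i j with rfl | hi
  · rw [Function.update_self, glue_self]
  · rw [Function.update_of_ne hi, glue_coe t y ⟨i, hi⟩, glue_coe s y ⟨i, hi⟩]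

theorem glue_restrict (j : ι) (x : ι → α) : glue j (x j) (fun i => x i) = x := by
  ext i
  by_cases hi : i = j <;> simp [glue, hi]

theorem continuous_glue [TopologicalSpace α] (j : ι) :
    Continuous fun z : ({i : ι // i ≠ j} → α) × α => glue j z.2 z.1 := by
  convert (Homeomorph.funSplitAt α j).symm.continuous.comp continuous_swap using 2 with z
  ext i
  simp [glue]

theorem continuous_glue_left [TopologicalSpace α] (j : ι) (a : α) :
    Continuous fun y : {i : ι // i ≠ j} → α => glue j a y :=
  (continuous_glue j).comp (.prodMk_left a)

theorem measurePreserving_splitAt [Fintype ι] (j : ι) :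
    MeasurePreserving (fun x : ι → ℝ => ((fun i : {i : ι // i ≠ j} => x i), x j)) := by
  -- Without this, `volume` on `{i // i = j} → ℝ` would be taken for the instance from `Unique`.
  let _ : Fintype {i : ι // i = j} := Subtype.fintype (· = j)
  have hunique :
      MeasurePreserving (MeasurableEquiv.funUnique {i : ι // i = j} ℝ) volume volume := by
    convert volume_preserving_funUnique {i : ι // i = j} ℝ
  have hsplit : MeasurePreserving (MeasurableEquiv.piEquivPiSubtypeProd (fun _ : ι => ℝ) (· = j))
      volume (volume.prod volume) := by
    exact volume_preserving_piEquivPiSubtypeProd (fun _ : ι => ℝ) (· = j)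
  exact Measure.measurePreserving_swap.comp ((hunique.prod (.id volume)).comp hsplit)

theorem measurableEmbedding_splitAt {κ : Type*} [Countable κ] (j : κ) :
    MeasurableEmbedding (fun x : κ → ℝ => ((fun i : {i : κ // i ≠ j} => x i), x j)) := by
  classical exact ((Homeomorph.funSplitAt ℝ j).trans (Homeomorph.prodComm _ _)).measurableEmbedding

theorem continuous_intervalIntegral_glue {f : (ι → ℝ) → ℝ} (hf : Continuous f) (j : ι) (a b : ℝ) :
    Continuous fun y : {i : ι // i ≠ j} → ℝ => ∫ s in (0 : ℝ)..1, f (glue j (a + b * s) y) := by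
  refine intervalIntegral.continuous_parametric_intervalIntegral_of_continuous' ?_ 0 1
  exact hf.comp ((continuous_glue j).comp (f := fun z : ({i : ι // i ≠ j} → ℝ) × ℝ =>
    (z.1, a + b * z.2)) (by fun_prop))

end Glue

section Slice

variable {ι R : Type*} [DecidableEq ι] [CommSemiring R]

/-- The restriction of a polynomial to the line of the points `glue j t y`, as a polynomial in `t`:
the univariate estimates are applied to these restrictions. -/
def slice (j : ι) (y : {i : ι // i ≠ j} → R) : MvPolynomial ι R →ₐ[R] Polynomial R :=
  MvPolynomial.aeval (glue j Polynomial.X fun i => Polynomial.C (y i))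

theorem eval_slice (j : ι) (y : {i : ι // i ≠ j} → R) (q : MvPolynomial ι R) (t : R) :
    (slice j y q).eval t = MvPolynomial.eval (glue j t y) q := by
  have h : (Polynomial.aeval t).comp (slice j y) = MvPolynomial.aeval (glue j t y) := by
    refine MvPolynomial.algHom_ext fun i => ?_
    by_cases hi : i = j <;> simp [slice, glue, hi]
  exact DFunLike.congr_fun h q

theorem derivative_slice (j : ι) (y : {i : ι // i ≠ j} → R) (q : MvPolynomial ι R) :
    Polynomial.derivative (slice j y q) = slice j y (MvPolynomial.pderiv j q) := by
  induction q using MvPolynomial.induction_on with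
  | C a => simp [slice]
  | add p q hp hq => simp only [map_add, hp, hq]
  | mul_X p i hp =>
    simp only [MvPolynomial.pderiv_mul, map_add, map_mul, Polynomial.derivative_mul, hp]
    by_cases hi : i = j
    · subst hi; simp [slice, glue_self]
    · simp [slice, glue, hi]

theorem iterate_derivative_slice (j : ι) (y : {i : ι // i ≠ j} → R) (k : ℕ)
    (q : MvPolynomial ι R) :
    Polynomial.derivative^[k] (slice j y q) = slice j y ((MvPolynomial.pderiv j)^[k] q) :=
  ((Function.Semiconj.iterate_right (f := slice j y) (ga := MvPolynomial.pderiv j)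
    (gb := Polynomial.derivative) fun q => (derivative_slice j y q).symm) k q).symm

theorem natDegree_slice_le (j : ι) (y : {i : ι // i ≠ j} → R) (q : MvPolynomial ι R) :
    (slice j y q).natDegree ≤ q.degreeOf j := by
  rw [slice, MvPolynomial.aeval_def, MvPolynomial.eval₂_eq]
  refine Polynomial.natDegree_sum_le_of_forall_le _ _ fun m hm => ?_
  have hfactor : ∀ i ∈ m.support,
      (glue j Polynomial.X (fun i => Polynomial.C (y i)) i ^ m i).natDegree ≤
        if i = j then m j else 0 := fun i _ => by
    by_cases hi : i = j
    · subst hi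
      simpa [glue_self] using Polynomial.natDegree_X_pow_le (R := R) (m i)
    · simpa [glue, hi] using Polynomial.natDegree_pow_le (p := Polynomial.C (y ⟨i, hi⟩)) (n := m i)
  refine (Polynomial.natDegree_C_mul_le _ _).trans <| (Polynomial.natDegree_prod_le _ _).trans <|
    (Finset.sum_le_sum hfactor).trans ?_
  rw [Finset.sum_ite_eq']
  split_ifs
  · exact MvPolynomial.monomial_le_degreeOf j hm
  · exact Nat.zero_le _

theorem continuous_eval_iterate_derivative_slice [TopologicalSpace R] [IsTopologicalSemiring R]
    (j : ι) (k : ℕ) (a : R) (q : MvPolynomial ι R) :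
    Continuous fun y => (Polynomial.derivative^[k] (slice j y q)).eval a := by
  simp only [iterate_derivative_slice, eval_slice]
  exact (MvPolynomial.continuous_eval _).comp (continuous_glue_left j a)

end Slice

section Cells

variable {d : ℕ} {o : Fin d → ℝ} {h : ℝ} {c : Fin d → ℤ} {j : Fin d}

/-- The common face of the cells `c` and `nextCell c j` in the coordinates `x_i`, `i ≠ j`: the
domain of integration of `ImmersedDomain.faceIntegral`. -/
def faceBox (o : Fin d → ℝ) (h : ℝ) (c : Fin d → ℤ) (j : Fin d) :
    Set ({i : Fin d // i ≠ j} → ℝ) :=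
  {y | ∀ i : {i : Fin d // i ≠ j}, o i.1 + h * (c i.1 : ℝ) ≤ y i ∧
    y i ≤ o i.1 + h * ((c i.1 : ℝ) + 1)}

/-- The interval of the values of the `j`-th coordinate on a cell. -/
def side (o : Fin d → ℝ) (h : ℝ) (c : Fin d → ℤ) (j : Fin d) : Set ℝ :=
  Set.Icc (o j + h * (c j : ℝ)) (o j + h * ((c j : ℝ) + 1))

/-- The coordinate `x_j` on the face between `c` and `nextCell c j`. -/
def faceCoord (o : Fin d → ℝ) (h : ℝ) (c : Fin d → ℤ) (j : Fin d) : ℝ :=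
  o j + h * ((c j : ℝ) + 1)

theorem gridCell_eq_Icc (o : Fin d → ℝ) (h : ℝ) (c : Fin d → ℤ) :
    gridCell o h c = Set.Icc (fun i => o i + h * (c i : ℝ)) (fun i => o i + h * ((c i : ℝ) + 1)) :=
  Set.ext fun _ => forall_and

theorem faceBox_eq_Icc (o : Fin d → ℝ) (h : ℝ) (c : Fin d → ℤ) (j : Fin d) :
    faceBox o h c j = Set.Icc (fun i => o i.1 + h * (c i.1 : ℝ))
      (fun i => o i.1 + h * ((c i.1 : ℝ) + 1)) :=
  Set.ext fun _ => forall_and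

theorem isCompact_gridCell (o : Fin d → ℝ) (h : ℝ) (c : Fin d → ℤ) : IsCompact (gridCell o h c) :=
  gridCell_eq_Icc o h c ▸ isCompact_Icc

theorem isCompact_faceBox (o : Fin d → ℝ) (h : ℝ) (c : Fin d → ℤ) (j : Fin d) :
    IsCompact (faceBox o h c j) :=
  faceBox_eq_Icc o h c j ▸ isCompact_Icc

theorem faceBox_nextCell (o : Fin d → ℝ) (h : ℝ) (c : Fin d → ℤ) (j : Fin d) :
    faceBox o h (nextCell c j) j = faceBox o h c j := by
  refine Set.ext fun y => forall_congr' fun i => ?_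
  rw [nextCell, Function.update_of_ne i.2]

theorem glue_mem_gridCell {t : ℝ} {y : {i : Fin d // i ≠ j} → ℝ} :
    glue j t y ∈ gridCell o h c ↔ y ∈ faceBox o h c j ∧ t ∈ side o h c j := by
  constructor
  · intro hx
    refine ⟨fun i => by simpa only [glue_coe] using hx i, ?_⟩
    simpa only [side, Set.mem_Icc, glue_self] using hx j
  · rintro ⟨hy, ht⟩ i
    rcases eq_or_ne i j with rfl | hi
    · simpa only [side, Set.mem_Icc, glue_self] using ht
    · simpa only [glue_coe t y ⟨i, hi⟩] using hy ⟨i, hi⟩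

theorem faceCoord_mem_side (hh : 0 ≤ h) : faceCoord o h c j ∈ side o h c j := by
  constructor <;> simp only [faceCoord] <;> nlinarith

theorem side_nextCell :
    side o h (nextCell c j) j = Set.Icc (faceCoord o h c j) (faceCoord o h c j + h) := by
  simp only [side, nextCell, faceCoord, Function.update_self]
  push_cast
  congr 1
  ring

theorem faceCoord_mem_side_nextCell (hh : 0 ≤ h) :
    faceCoord o h c j ∈ side o h (nextCell c j) j := by
  rw [side_nextCell]
  exact ⟨le_rfl, by linarith⟩

theorem integral_gridCell (o : Fin d → ℝ) (h : ℝ) (c : Fin d → ℤ) (j : Fin d)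
    {f : (Fin d → ℝ) → ℝ} (hf : Continuous f) :
    ∫ x in gridCell o h c, f x =
      ∫ y in faceBox o h c j, ∫ t in side o h c j, f (glue j t y) := by
  have hpre : (fun x : Fin d → ℝ => ((fun i : {i : Fin d // i ≠ j} => x i), x j)) ⁻¹'
      (faceBox o h c j ×ˢ side o h c j) = gridCell o h c := by
    ext x
    conv_rhs => rw [← glue_restrict j x]
    rw [glue_mem_gridCell, Set.mem_preimage, Set.mem_prod]
  have hsplit := (measurePreserving_splitAt j).setIntegral_preimage_emb
    (measurableEmbedding_splitAt j) (fun z => f (glue j z.2 z.1)) (faceBox o h c j ×ˢ side o h c j)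
  simp only [hpre, glue_restrict] at hsplit
  rw [hsplit]
  exact setIntegral_prod _ <| (hf.comp (continuous_glue j)).continuousOn.integrableOn_compact
    ((isCompact_faceBox o h c j).prod isCompact_Icc)

end Cells

section FaceInequalities

variable {d : ℕ} {o : Fin d → ℝ} {h : ℝ} {c : Fin d → ℤ} {j : Fin d}

/-- The `k`-th derivative of the polynomial `q` in direction `x_j` on the face between `c` and
`nextCell c j`; it stands for `∂_n^k` in the estimates of the jumps. -/
def faceDeriv (o : Fin d → ℝ) (h : ℝ) (c : Fin d → ℤ) (j : Fin d) (k : ℕ)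
    (q : MvPolynomial (Fin d) ℝ) (y : {i : Fin d // i ≠ j} → ℝ) : ℝ :=
  (Polynomial.derivative^[k] (slice j y q)).eval (faceCoord o h c j)

/-- The squared `L²` norm of `q` over the layer of signed thickness `b` at the face between `c` and
`nextCell c j`. The factor `h` normalizes it for `b = h` (the cell `nextCell c j`) and `b = -h` (the
cell `c`), so that both sides of the face are treated at once. -/
def sideEnergy (o : Fin d → ℝ) (h : ℝ) (c : Fin d → ℤ) (j : Fin d) (b : ℝ)
    (q : MvPolynomial (Fin d) ℝ) : ℝ :=
  h * ∫ y in faceBox o h c j, ∫ s in (0 : ℝ)..1, (slice j y q).eval (faceCoord o h c j + b * s) ^ 2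

/-- The contribution of the face between `c` and `nextCell c j` to the stabilization, for a function
given by the polynomials `q` and `r` on the two sides of the face. -/
def jumpEnergy (o : Fin d → ℝ) (h : ℝ) (c : Fin d → ℤ) (j : Fin d) (p : ℕ) (w : ℕ → ℝ)
    (q r : MvPolynomial (Fin d) ℝ) : ℝ :=
  ∑ k ∈ Finset.Icc 1 p, w k * (h ^ (2 * k + 1) / ((2 * k + 1) * (k.factorial : ℝ) ^ 2)) *
    ∫ y in faceBox o h c j, (faceDeriv o h c j k q y - faceDeriv o h c j k r y) ^ 2

theorem jumpEnergy_comm (p : ℕ) (w : ℕ → ℝ) (q r : MvPolynomial (Fin d) ℝ) :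
    jumpEnergy o h c j p w q r = jumpEnergy o h c j p w r q := by
  simp only [jumpEnergy, sub_sq_comm (faceDeriv o h c j _ q _)]

theorem sideEnergy_eq_integral_nextCell (hh : 0 < h) (q : MvPolynomial (Fin d) ℝ) :
    sideEnergy o h c j h q =
      ∫ x in gridCell o h (nextCell c j), MvPolynomial.eval x q ^ 2 := by
  rw [integral_gridCell o h _ j (f := fun x => MvPolynomial.eval x q ^ 2)
      ((MvPolynomial.continuous_eval q).pow 2), faceBox_nextCell,
    sideEnergy, ← integral_const_mul, side_nextCell]
  simp only [eval_slice]
  congr 1; ext y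
  rw [integral_Icc_eq_integral_Ioc, ← intervalIntegral.integral_of_le (by linarith),
    intervalIntegral.mul_integral_comp_add_mul
      (f := fun t => MvPolynomial.eval (glue j t y) q ^ 2), mul_zero, add_zero, mul_one]

theorem sideEnergy_neg_eq_integral (hh : 0 < h) (q : MvPolynomial (Fin d) ℝ) :
    sideEnergy o h c j (-h) q = ∫ x in gridCell o h c, MvPolynomial.eval x q ^ 2 := by
  have hside : side o h c j = Set.Icc (faceCoord o h c j + -h) (faceCoord o h c j) := by
    simp only [side, faceCoord]; congr 1; ring
  rw [integral_gridCell o h _ j (f := fun x => MvPolynomial.eval x q ^ 2)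
      ((MvPolynomial.continuous_eval q).pow 2),
    sideEnergy, ← integral_const_mul, hside]
  simp only [eval_slice]
  congr 1; ext y
  rw [integral_Icc_eq_integral_Ioc, ← intervalIntegral.integral_of_le (by linarith),
    intervalIntegral.integral_symm, mul_neg, ← neg_mul,
    intervalIntegral.mul_integral_comp_add_mul
      (f := fun t => MvPolynomial.eval (glue j t y) q ^ 2), mul_zero, add_zero, mul_one]

theorem continuous_faceDeriv (k : ℕ) (q : MvPolynomial (Fin d) ℝ) :
    Continuous (faceDeriv o h c j k q) :=
  continuous_eval_iterate_derivative_slice j k _ q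

theorem continuous_integral_sq_slice (q : MvPolynomial (Fin d) ℝ) (a b : ℝ) :
    Continuous fun y : {i : Fin d // i ≠ j} → ℝ =>
      ∫ s in (0 : ℝ)..1, (slice j y q).eval (a + b * s) ^ 2 := by
  simp only [eval_slice]
  exact continuous_intervalIntegral_glue ((MvPolynomial.continuous_eval q).pow 2) j a b

theorem integrableOn_faceBox {f : ({i : Fin d // i ≠ j} → ℝ) → ℝ} (hf : Continuous f) :
    IntegrableOn f (faceBox o h c j) :=
  hf.continuousOn.integrableOn_compact (isCompact_faceBox o h c j)

theorem mul_integral_faceBox_mono {f g : ({i : Fin d // i ≠ j} → ℝ) → ℝ} (hh : 0 ≤ h)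
    (hf : Continuous f) (hg : Continuous g) (hfg : ∀ y ∈ faceBox o h c j, f y ≤ g y) :
    h * ∫ y in faceBox o h c j, f y ≤ h * ∫ y in faceBox o h c j, g y :=
  mul_le_mul_of_nonneg_left (setIntegral_mono_on (integrableOn_faceBox hf) (integrableOn_faceBox hg)
    (isCompact_faceBox o h c j).measurableSet hfg) hh

theorem sideEnergy_le_weightL_mul {p : ℕ} {C : ℝ} (hC : 0 < C) {w : ℕ → ℝ}
    (hw : ∀ k ∈ Finset.Icc 1 p, 0 < w k) (hh : 0 ≤ h) {b : ℝ} (hb : b ^ 2 = h ^ 2)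
    {q r : MvPolynomial (Fin d) ℝ} (hq : q.degreeOf j ≤ p) (hr : r.degreeOf j ≤ p)
    (hqr : ∀ y ∈ faceBox o h c j, MvPolynomial.eval (glue j (faceCoord o h c j) y) q =
      MvPolynomial.eval (glue j (faceCoord o h c j) y) r) :
    sideEnergy o h c j b q ≤
      weightL C p w * (C⁻¹ * sideEnergy o h c j b r + jumpEnergy o h c j p w q r) := by
  have hcont := continuous_integral_sq_slice (j := j) r (faceCoord o h c j) b
  have hcontDeriv : ∀ k, Continuous fun y =>
      (faceDeriv o h c j k q y - faceDeriv o h c j k r y) ^ 2 :=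
    fun k => ((continuous_faceDeriv k q).sub (continuous_faceDeriv k r)).pow 2
  calc sideEnergy o h c j b q
      ≤ h * ∫ y in faceBox o h c j, weightL C p w *
          (C⁻¹ * (∫ s in (0 : ℝ)..1, (slice j y r).eval (faceCoord o h c j + b * s) ^ 2) +
            ∑ k ∈ Finset.Icc 1 p, w k * (b ^ (2 * k) / ((2 * k + 1) * (k.factorial : ℝ) ^ 2)) *
              (faceDeriv o h c j k q y - faceDeriv o h c j k r y) ^ 2) :=
        mul_integral_faceBox_mono hh (continuous_integral_sq_slice q _ _) (by fun_prop)
          fun y hy => integral_sq_le_weightL_mul hC hw ((natDegree_slice_le j y q).trans hq)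
            ((natDegree_slice_le j y r).trans hr) (by simpa only [eval_slice] using hqr y hy) b
    _ = _ := by
        rw [integral_const_mul, integral_add (integrableOn_faceBox (by fun_prop))
          (integrableOn_faceBox (by fun_prop)), integral_const_mul,
          integral_finsetSum _ fun k _ => integrableOn_faceBox (by fun_prop)]
        simp only [integral_const_mul, sideEnergy, jumpEnergy, pow_mul b, hb, pow_succ h,
          mul_left_comm h, mul_add h, Finset.mul_sum]
        congr! 3 with k
        ring

theorem integral_faceDeriv_sq_le {p k : ℕ} (hp : 1 ≤ p) (hk : k ≤ p) (hh : 0 ≤ h) {b : ℝ}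
    (hb : b ^ 2 = h ^ 2) {q : MvPolynomial (Fin d) ℝ} (hq : q.degreeOf j ≤ p) :
    h ^ (2 * k + 1) * ∫ y in faceBox o h c j, faceDeriv o h c j k q y ^ 2 ≤
      36 * (p : ℝ) ^ (4 * k + 2) * sideEnergy o h c j b q := by
  have hcont := continuous_integral_sq_slice (j := j) q (faceCoord o h c j) b
  have hcontDeriv := continuous_faceDeriv (o := o) (h := h) (c := c) (j := j) k q
  calc h ^ (2 * k + 1) * ∫ y in faceBox o h c j, faceDeriv o h c j k q y ^ 2
      = h * ∫ y in faceBox o h c j, b ^ (2 * k) * faceDeriv o h c j k q y ^ 2 := by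
        rw [integral_const_mul, pow_mul b, hb, ← pow_mul, pow_succ]; ring
    _ ≤ h * ∫ y in faceBox o h c j, 36 * (p : ℝ) ^ (4 * k + 2) *
          ∫ s in (0 : ℝ)..1, (slice j y q).eval (faceCoord o h c j + b * s) ^ 2 :=
        mul_integral_faceBox_mono hh (by fun_prop) (by fun_prop) fun y _ =>
          sq_iterate_derivative_le_integral hp hk ((natDegree_slice_le j y q).trans hq) _ b
    _ = _ := by rw [integral_const_mul, sideEnergy]; ring

theorem integral_faceDeriv_sub_sq_le (k : ℕ) (q r : MvPolynomial (Fin d) ℝ) :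
    ∫ y in faceBox o h c j, (faceDeriv o h c j k q y - faceDeriv o h c j k r y) ^ 2 ≤
      2 * ((∫ y in faceBox o h c j, faceDeriv o h c j k q y ^ 2) +
        ∫ y in faceBox o h c j, faceDeriv o h c j k r y ^ 2) := by
  have hq := continuous_faceDeriv (o := o) (h := h) (c := c) (j := j) k q
  have hr := continuous_faceDeriv (o := o) (h := h) (c := c) (j := j) k r
  rw [← integral_add (integrableOn_faceBox (by fun_prop)) (integrableOn_faceBox (by fun_prop)),
    ← integral_const_mul]
  refine setIntegral_mono (integrableOn_faceBox (by fun_prop)) (integrableOn_faceBox (by fun_prop))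
    fun y => ?_
  simpa only [← sub_eq_add_neg, even_two.neg_pow] using
    add_sq_le (a := faceDeriv o h c j k q y) (b := -faceDeriv o h c j k r y)

theorem jumpEnergy_le {p : ℕ} {w : ℕ → ℝ} (hw : ∀ k ∈ Finset.Icc 1 p, 0 < w k) (hh : 0 < h)
    {q r : MvPolynomial (Fin d) ℝ} (hq : q.degreeOf j ≤ p) (hr : r.degreeOf j ≤ p) :
    jumpEnergy o h c j p w q r ≤
      72 * weightG p w * (sideEnergy o h c j (-h) q + sideEnergy o h c j h r) := by
  rw [weightG, Finset.mul_sum, Finset.sum_mul]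
  refine Finset.sum_le_sum fun k hk => ?_
  obtain ⟨hk1, hkp⟩ := Finset.mem_Icc.1 hk
  have hw0 := hw k hk
  have hp := hk1.trans hkp
  have hjump : h ^ (2 * k + 1) * ∫ y in faceBox o h c j,
        (faceDeriv o h c j k q y - faceDeriv o h c j k r y) ^ 2 ≤
      72 * (p : ℝ) ^ (4 * k + 2) * (sideEnergy o h c j (-h) q + sideEnergy o h c j h r) := by
    have hmono := mul_le_mul_of_nonneg_left (integral_faceDeriv_sub_sq_le (o := o) (h := h) (c := c)
      (j := j) k q r) (pow_nonneg hh.le (2 * k + 1))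
    have hleft := integral_faceDeriv_sq_le (o := o) (c := c) (j := j) hp hkp hh.le (neg_sq h) hq
    have hright := integral_faceDeriv_sq_le (o := o) (c := c) (j := j) hp hkp hh.le rfl hr
    linarith
  calc w k * (h ^ (2 * k + 1) / ((2 * k + 1) * (k.factorial : ℝ) ^ 2)) *
        ∫ y in faceBox o h c j, (faceDeriv o h c j k q y - faceDeriv o h c j k r y) ^ 2
      = w k / ((2 * k + 1) * (k.factorial : ℝ) ^ 2) * (h ^ (2 * k + 1) *
          ∫ y in faceBox o h c j, (faceDeriv o h c j k q y - faceDeriv o h c j k r y) ^ 2) := by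
        ring
    _ ≤ w k / ((2 * k + 1) * (k.factorial : ℝ) ^ 2) * _ :=
        mul_le_mul_of_nonneg_left hjump (by positivity)
    _ = _ := by ring

theorem exists_sideEnergy_neg_le (d p : ℕ) :
    ∃ K : ℝ, ∀ (o : Fin d → ℝ) (h : ℝ), 0 ≤ h → ∀ (c : Fin d → ℤ) (j : Fin d) (b : ℝ)
      (q : MvPolynomial (Fin d) ℝ), q.degreeOf j ≤ p →
        sideEnergy o h c j (-b) q ≤ K * sideEnergy o h c j b q := by
  obtain ⟨K, hK⟩ := exists_integral_reflect_le p
  refine ⟨K, fun o h hh c j b q hq => ?_⟩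
  rw [sideEnergy, sideEnergy, mul_left_comm K, ← integral_const_mul K]
  refine mul_integral_faceBox_mono hh (continuous_integral_sq_slice q _ _)
    ((continuous_integral_sq_slice q _ _).const_mul K) fun y _ => ?_
  simpa only [neg_mul, ← sub_eq_add_neg] using
    hK (slice j y q) ((natDegree_slice_le j y q).trans hq) (faceCoord o h c j) b

theorem exists_isNeighbourConst (d p : ℕ) : ∃ C, IsNeighbourConst d p C := by
  obtain ⟨K, hK⟩ := exists_sideEnergy_neg_le d p
  refine ⟨K, fun o h hh c c' hcc q hq => ?_⟩
  obtain ⟨j, rfl | rfl⟩ := hcc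
  · simpa only [sideEnergy_neg_eq_integral hh, sideEnergy_eq_integral_nextCell hh] using
      hK o h hh.le c j h q (hq j)
  · simpa only [neg_neg, sideEnergy_neg_eq_integral hh, sideEnergy_eq_integral_nextCell hh] using
      hK o h hh.le c' j (-h) q (hq j)

theorem IsNeighbourConst.one_le {p : ℕ} (hd : 1 ≤ d) {C : ℝ} (hC : IsNeighbourConst d p C) :
    1 ≤ C := by
  have hvol : ∀ c : Fin d → ℤ, volume.real (gridCell (0 : Fin d → ℝ) 1 c) = 1 := fun c => by
    rw [gridCell_eq_Icc, Measure.real, Real.volume_Icc_pi_toReal (fun i => by simp)]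
    simp
  have := hC 0 1 one_pos 0 (nextCell 0 ⟨0, hd⟩) ⟨⟨0, hd⟩, Or.inl rfl⟩ 1 (by simp)
  simpa [hvol] using this

end FaceInequalities

section LocalEstimates

variable {d : ℕ} {p : ℕ}

theorem weightG_nonneg {w : ℕ → ℝ} (hw : ∀ k ∈ Finset.Icc 1 p, 0 < w k) : 0 ≤ weightG p w :=
  Finset.sum_nonneg fun k hk => mul_nonneg (hw k hk).le (by positivity)

theorem le_weightL (C : ℝ) {w : ℕ → ℝ} (hw : ∀ k ∈ Finset.Icc 1 p, 0 < w k) :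
    C ≤ weightL C p w :=
  le_add_of_nonneg_right (Finset.sum_nonneg fun k hk => (one_div_pos.2 (hw k hk)).le)

namespace ImmersedDomain

variable (D : ImmersedDomain d)

/-- On the cell `c` the function `v` is the polynomial `q`, of degree at most `p` in each variable;
this is how the elements of `feSpace` are accessed. -/
structure IsLocalPoly (p : ℕ) (v : (Fin d → ℝ) → ℝ) (c : Fin d → ℤ)
    (q : MvPolynomial (Fin d) ℝ) : Prop where
  degreeOf_le : ∀ i, q.degreeOf i ≤ p
  eq_eval : ∀ x ∈ D.cell c, v x = MvPolynomial.eval x q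

/-- The squared `L²` norm of `v` on the cell `c`. -/
def cellEnergy (v : (Fin d → ℝ) → ℝ) (c : Fin d → ℤ) : ℝ := ∫ x in D.cell c, v x ^ 2

/-- The contribution of the face `F` to `D.stab p w v v`, with the encoding of faces as in
`cutFaces`. -/
def faceEnergy (p : ℕ) (w : ℕ → ℝ) (v : (Fin d → ℝ) → ℝ) (F : (Fin d → ℤ) × Fin d) : ℝ :=
  ∑ k ∈ Finset.Icc 1 p, w k * (D.h ^ (2 * k + 1) / ((2 * k + 1) * (k.factorial : ℝ) ^ 2)) *
    D.faceIntegral F.1 F.2 (fun x => D.jump F.1 F.2 k v x * D.jump F.1 F.2 k v x)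

variable {D} {v : (Fin d → ℝ) → ℝ} {c : Fin d → ℤ} {j : Fin d} {q r : MvPolynomial (Fin d) ℝ}

theorem exists_isLocalPoly (hv : v ∈ D.feSpace p) (hc : c ∈ D.cells) :
    ∃ q, D.IsLocalPoly p v c q := by
  obtain ⟨q, hq, hqv⟩ := hv.2.2 c hc
  exact ⟨q, hq, hqv⟩

theorem cellEnergy_nonneg (v : (Fin d → ℝ) → ℝ) (c : Fin d → ℤ) : 0 ≤ D.cellEnergy v c :=
  integral_nonneg fun _ => sq_nonneg _

theorem faceEnergy_nonneg {w : ℕ → ℝ} (hw : ∀ k ∈ Finset.Icc 1 p, 0 < w k)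
    (v : (Fin d → ℝ) → ℝ) (F : (Fin d → ℤ) × Fin d) : 0 ≤ D.faceEnergy p w v F := by
  have hh := D.h_pos
  exact Finset.sum_nonneg fun k hk => mul_nonneg (mul_nonneg (hw k hk).le (by positivity))
    (integral_nonneg fun _ => mul_self_nonneg _)

theorem measurableSet_cell (c : Fin d → ℤ) : MeasurableSet (D.cell c) :=
  (isCompact_gridCell D.o D.h c).measurableSet

theorem IsLocalPoly.cellEnergy_eq (hq : D.IsLocalPoly p v c q) :
    D.cellEnergy v c = ∫ x in gridCell D.o D.h c, MvPolynomial.eval x q ^ 2 :=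
  setIntegral_congr_fun (measurableSet_cell c) fun x hx => by simp only [hq.eq_eval x hx]

theorem IsLocalPoly.cellDeriv_glue (hq : D.IsLocalPoly p v c q) (j : Fin d) (k : ℕ)
    {y : {i : Fin d // i ≠ j} → ℝ} (hy : y ∈ faceBox D.o D.h c j) {t : ℝ}
    (ht : t ∈ side D.o D.h c j) :
    D.cellDeriv c j k v (glue j t y) = (Polynomial.derivative^[k] (slice j y q)).eval t := by
  have heq : Set.EqOn (fun s => v (Function.update (glue j t y) j s))
      (fun s => (slice j y q).eval s) (side D.o D.h c j) := fun s hs => by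
    simp only [update_glue, eval_slice]
    exact hq.eq_eval _ (glue_mem_gridCell.2 ⟨hy, hs⟩)
  rw [cellDeriv, glue_self]
  exact (iteratedDerivWithin_congr heq ht).trans
    (iteratedDerivWithin_eval (uniqueDiffOn_Icc (by nlinarith [D.h_pos])) k ht)

theorem IsLocalPoly.jump_glue (hq : D.IsLocalPoly p v c q)
    (hr : D.IsLocalPoly p v (nextCell c j) r) (k : ℕ) {y : {i : Fin d // i ≠ j} → ℝ}
    (hy : y ∈ faceBox D.o D.h c j) :
    D.jump c j k v (glue j (faceCoord D.o D.h c j) y) =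
      faceDeriv D.o D.h c j k r y - faceDeriv D.o D.h c j k q y := by
  rw [jump, hq.cellDeriv_glue j k hy (faceCoord_mem_side D.h_pos.le),
    hr.cellDeriv_glue j k (by rwa [faceBox_nextCell]) (faceCoord_mem_side_nextCell D.h_pos.le),
    faceDeriv, faceDeriv]

theorem IsLocalPoly.eval_glue_eq (hq : D.IsLocalPoly p v c q)
    (hr : D.IsLocalPoly p v (nextCell c j) r) {y : {i : Fin d // i ≠ j} → ℝ}
    (hy : y ∈ faceBox D.o D.h c j) :
    MvPolynomial.eval (glue j (faceCoord D.o D.h c j) y) q =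
      MvPolynomial.eval (glue j (faceCoord D.o D.h c j) y) r := by
  rw [← hq.eq_eval _ (glue_mem_gridCell.2 ⟨hy, faceCoord_mem_side D.h_pos.le⟩),
    ← hr.eq_eval _ (glue_mem_gridCell.2
      ⟨by rwa [faceBox_nextCell], faceCoord_mem_side_nextCell D.h_pos.le⟩)]

theorem faceIntegral_eq (c : Fin d → ℤ) (j : Fin d) (f : (Fin d → ℝ) → ℝ) :
    D.faceIntegral c j f =
      ∫ y in faceBox D.o D.h c j, f (glue j (faceCoord D.o D.h c j) y) :=
  rfl

theorem IsLocalPoly.faceEnergy_eq_jumpEnergy (hq : D.IsLocalPoly p v c q)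
    (hr : D.IsLocalPoly p v (nextCell c j) r) (w : ℕ → ℝ) :
    D.faceEnergy p w v (c, j) = jumpEnergy D.o D.h c j p w q r := by
  rw [jumpEnergy_comm]
  refine Finset.sum_congr rfl fun k _ => ?_
  rw [faceIntegral_eq]
  congr 1
  refine setIntegral_congr_fun (isCompact_faceBox _ _ _ _).measurableSet fun y hy => ?_
  simp only [hq.jump_glue hr k hy, sq]

theorem faceEnergy_le {w : ℕ → ℝ} (hw : ∀ k ∈ Finset.Icc 1 p, 0 < w k) (hv : v ∈ D.feSpace p)
    (hc : c ∈ D.cells) (hc' : nextCell c j ∈ D.cells) :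
    D.faceEnergy p w v (c, j) ≤
      72 * weightG p w * (D.cellEnergy v c + D.cellEnergy v (nextCell c j)) := by
  obtain ⟨q, hq⟩ := exists_isLocalPoly hv hc
  obtain ⟨r, hr⟩ := exists_isLocalPoly hv hc'
  rw [hq.faceEnergy_eq_jumpEnergy hr, hq.cellEnergy_eq, hr.cellEnergy_eq,
    ← sideEnergy_neg_eq_integral D.h_pos, ← sideEnergy_eq_integral_nextCell D.h_pos]
  exact jumpEnergy_le hw D.h_pos (hq.degreeOf_le j) (hr.degreeOf_le j)

variable {C : ℝ} {w : ℕ → ℝ}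

theorem cellEnergy_nextCell_le (hC : 0 < C) (hN : IsNeighbourConst d p C)
    (hw : ∀ k ∈ Finset.Icc 1 p, 0 < w k) (hv : v ∈ D.feSpace p) (hc : c ∈ D.cells)
    (hc' : nextCell c j ∈ D.cells) :
    D.cellEnergy v (nextCell c j) ≤
      weightL C p w * (D.cellEnergy v c + D.faceEnergy p w v (c, j)) := by
  obtain ⟨q, hq⟩ := exists_isLocalPoly hv hc
  obtain ⟨r, hr⟩ := exists_isLocalPoly hv hc'
  have htaylor := sideEnergy_le_weightL_mul hC hw D.h_pos.le (b := D.h) rfl (hr.degreeOf_le j)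
    (hq.degreeOf_le j) fun y hy => (hq.eval_glue_eq hr hy).symm
  have hext := hN D.o D.h D.h_pos (nextCell c j) c ⟨j, .inr rfl⟩ q hq.degreeOf_le
  rw [sideEnergy_eq_integral_nextCell D.h_pos, sideEnergy_eq_integral_nextCell D.h_pos,
    jumpEnergy_comm, ← hq.faceEnergy_eq_jumpEnergy hr, ← hr.cellEnergy_eq] at htaylor
  rw [← hq.cellEnergy_eq, ← inv_mul_le_iff₀ hC] at hext
  exact htaylor.trans (mul_le_mul_of_nonneg_left (by gcongr) (hC.le.trans (le_weightL C hw)))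

theorem cellEnergy_le_nextCell (hC : 0 < C) (hN : IsNeighbourConst d p C)
    (hw : ∀ k ∈ Finset.Icc 1 p, 0 < w k) (hv : v ∈ D.feSpace p) (hc : c ∈ D.cells)
    (hc' : nextCell c j ∈ D.cells) :
    D.cellEnergy v c ≤
      weightL C p w * (D.cellEnergy v (nextCell c j) + D.faceEnergy p w v (c, j)) := by
  obtain ⟨q, hq⟩ := exists_isLocalPoly hv hc
  obtain ⟨r, hr⟩ := exists_isLocalPoly hv hc'
  have htaylor := sideEnergy_le_weightL_mul hC hw D.h_pos.le (neg_sq D.h) (hq.degreeOf_le j)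
    (hr.degreeOf_le j) fun y hy => hq.eval_glue_eq hr hy
  have hext := hN D.o D.h D.h_pos c (nextCell c j) ⟨j, .inl rfl⟩ r hr.degreeOf_le
  rw [sideEnergy_neg_eq_integral D.h_pos, sideEnergy_neg_eq_integral D.h_pos,
    ← hq.faceEnergy_eq_jumpEnergy hr, ← hq.cellEnergy_eq] at htaylor
  rw [← hr.cellEnergy_eq, ← inv_mul_le_iff₀ hC] at hext
  exact htaylor.trans (mul_le_mul_of_nonneg_left (by gcongr) (hC.le.trans (le_weightL C hw)))

end ImmersedDomain

end LocalEstimates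

section Mesh

variable {d : ℕ} {o : Fin d → ℝ} {h : ℝ}

theorem volume_gridCell_inter (hh : 0 < h) {c c' : Fin d → ℤ} (hne : c ≠ c') :
    volume (gridCell o h c ∩ gridCell o h c') = 0 := by
  obtain ⟨i, hi⟩ := Function.ne_iff.1 hne
  wlog hlt : c i < c' i generalizing c c'
  · rw [Set.inter_comm]
    exact this hne.symm hi.symm (hi.symm.lt_of_le (not_lt.1 hlt))
  refine measure_mono_null (fun x hx => ?_)
    (Measure.pi_hyperplane (fun _ : Fin d => (volume : Measure ℝ)) i (o i + h * (c' i : ℝ)))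
  have hcast : (c i : ℝ) + 1 ≤ c' i := by exact_mod_cast hlt
  exact le_antisymm ((hx.1 i).2.trans (by gcongr)) (hx.2 i).1

theorem gridCell_subset_closure_interior (hh : 0 < h) (c : Fin d → ℤ) :
    gridCell o h c ⊆ closure (interior (gridCell o h c)) := by
  rw [gridCell_eq_Icc, ← Set.pi_univ_Icc, interior_pi_set Set.finite_univ, closure_pi_set]
  intro x hx i hi
  exact (closure_interior_Icc (by nlinarith)).ge (hx i hi)

theorem isPreconnected_gridCell (o : Fin d → ℝ) (h : ℝ) (c : Fin d → ℤ) :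
    IsPreconnected (gridCell o h c) := by
  rw [gridCell_eq_Icc]
  exact (convex_Icc _ _).isPreconnected

theorem nextCell_injective (j : Fin d) : Function.Injective fun c : Fin d → ℤ => nextCell c j := by
  refine Function.LeftInverse.injective (g := fun c => Function.update c j (c j - 1)) fun c => ?_
  simp [nextCell]

theorem card_filter_shareFace_le (S : Finset (Fin d → ℤ)) (t : Fin d → ℤ)
    [DecidablePred fun c => ShareFace c t] : (S.filter fun c => ShareFace c t).card ≤ 2 * d := by
  have hsub : S.filter (fun c => ShareFace c t) ⊆ (({1, -1} : Finset ℤ) ×ˢ Finset.univ).image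
      fun e => Function.update t e.2 (t e.2 + e.1) := fun c hc => by
    obtain ⟨j, rfl | rfl⟩ := (Finset.mem_filter.1 hc).2
    · exact Finset.mem_image.2 ⟨(-1, j), by simp, by simp [nextCell]⟩
    · exact Finset.mem_image.2 ⟨(1, j), by simp, rfl⟩
  calc _ ≤ _ := (Finset.card_le_card hsub).trans Finset.card_image_le
    _ = 2 * d := by simp

namespace ImmersedDomain

variable {D : ImmersedDomain d} {p : ℕ} {v : (Fin d → ℝ) → ℝ}

theorem isCompact_meshDomain : IsCompact D.meshDomain :=
  D.cells.isCompact_biUnion fun c _ => isCompact_gridCell D.o D.h c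

theorem integrableOn_mul {u : (Fin d → ℝ) → ℝ} (hu : u ∈ D.feSpace p) (hv : v ∈ D.feSpace p)
    {X : Set (Fin d → ℝ)} (hX : X ⊆ D.meshDomain) : IntegrableOn (fun x => u x * v x) X :=
  ((hu.1.mul hv.1).integrableOn_compact isCompact_meshDomain).mono_set hX

theorem l2Inner_self_nonneg (X : Set (Fin d → ℝ)) (v : (Fin d → ℝ) → ℝ) : 0 ≤ l2Inner X v v :=
  integral_nonneg fun _ => mul_self_nonneg _

theorem l2Inner_self_mono (hv : v ∈ D.feSpace p) {X Y : Set (Fin d → ℝ)} (hXY : X ⊆ Y)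
    (hY : Y ⊆ D.meshDomain) : l2Inner X v v ≤ l2Inner Y v v :=
  setIntegral_mono_set (integrableOn_mul hv hv hY)
    (Filter.Eventually.of_forall fun x => mul_self_nonneg (v x)) hXY.eventuallyLE

theorem l2Inner_biUnion_cell_self (hv : v ∈ D.feSpace p) {T : Finset (Fin d → ℤ)}
    (hT : T ⊆ D.cells) : l2Inner (⋃ c ∈ T, D.cell c) v v = ∑ c ∈ T, D.cellEnergy v c := by
  have hint : IntegrableOn (fun x => v x * v x) (⋃ c ∈ T, D.cell c) :=
    integrableOn_mul hv hv (Set.biUnion_subset_biUnion_left hT)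
  have hunion : ⋃ c ∈ T, D.cell c = ⋃ c : T, D.cell c.1 := Set.biUnion_eq_iUnion _ _
  rw [hunion] at hint
  rw [l2Inner, hunion,
    integral_iUnion_ae (fun c => (measurableSet_cell _).nullMeasurableSet) _ hint,
    tsum_fintype, ← Finset.sum_coe_sort T]
  · simp only [cellEnergy, sq]
  · exact fun c c' hne => volume_gridCell_inter D.h_pos fun h => hne (Subtype.ext h)

theorem l2Inner_meshDomain_self (hv : v ∈ D.feSpace p) :
    l2Inner D.meshDomain v v = ∑ c ∈ D.cells, D.cellEnergy v c :=
  l2Inner_biUnion_cell_self hv subset_rfl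

theorem eqOn_zero_of_cellEnergy_eq_zero {c : Fin d → ℤ} (hv : v ∈ D.feSpace p) (hc : c ∈ D.cells)
    (h0 : D.cellEnergy v c = 0) : Set.EqOn v 0 (D.cell c) := by
  obtain ⟨q, hq⟩ := exists_isLocalPoly hv hc
  have hcont : Continuous fun x => MvPolynomial.eval x q ^ 2 :=
    (MvPolynomial.continuous_eval q).pow 2
  rw [hq.cellEnergy_eq, setIntegral_eq_zero_iff_of_nonneg_ae
    (Filter.Eventually.of_forall fun x => sq_nonneg _)
    (hcont.continuousOn.integrableOn_compact (isCompact_gridCell _ _ _))] at h0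
  have hzero := Measure.eqOn_of_ae_eq h0 hcont.continuousOn continuousOn_const
    (gridCell_subset_closure_interior D.h_pos c)
  intro x hx
  rw [hq.eq_eval x hx]
  exact pow_eq_zero_iff two_ne_zero |>.1 (hzero hx)

theorem l2Inner_meshDomain_pos (hv : v ∈ D.feSpace p) (hv0 : v ≠ 0) :
    0 < l2Inner D.meshDomain v v := by
  refine (l2Inner_self_nonneg _ _).lt_of_ne fun h0 => hv0 (funext fun x => ?_)
  rw [l2Inner_meshDomain_self hv, eq_comm,
    Finset.sum_eq_zero_iff_of_nonneg fun c _ => cellEnergy_nonneg v c] at h0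
  by_cases hx : x ∈ D.meshDomain
  · obtain ⟨c, hc, hxc⟩ := Set.mem_iUnion₂.1 hx
    exact eqOn_zero_of_cellEnergy_eq_zero hv hc (h0 c hc) hxc
  · exact hv.2.1 x hx

theorem cell_subset_Ω {c : Fin d → ℤ} (hc : c ∈ D.cells) (hcut : c ∉ D.cutCells) :
    D.cell c ⊆ D.Ω := by
  have hdisj : ∀ x ∈ D.cell c, x ∉ frontier D.Ω := fun x hx hx' =>
    hcut (by simpa [cutCells, hc] using ⟨x, hx, hx'⟩)
  refine (isPreconnected_gridCell _ _ _).subset_left_of_subset_union D.isOpen_Ω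
    isClosed_closure.isOpen_compl (disjoint_compl_right.mono_left subset_closure)
    (fun x hx => ?_) (D.cell_inter_Ω c hc)
  by_contra hmem
  rw [Set.mem_union, not_or, Set.notMem_compl_iff] at hmem
  exact hdisj x hx (D.isOpen_Ω.frontier_eq ▸ ⟨hmem.2, hmem.1⟩)

theorem cutCells_subset : D.cutCells ⊆ D.cells := by
  classical exact Finset.filter_subset _ _

theorem mem_cutFaces {c : Fin d → ℤ} {j : Fin d} :
    (c, j) ∈ D.cutFaces ↔ c ∈ D.cells ∧ nextCell c j ∈ D.cells ∧
      (c ∈ D.cutCells ∨ nextCell c j ∈ D.cutCells) := by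
  simp [cutFaces]

end ImmersedDomain

end Mesh

section Reach

variable {d : ℕ}

namespace ImmersedDomain

open Classical in
/-- The elements from which an uncut element can be reached in at most `n` jumps as in
`ResolvedWithin`; the `L²` norm is controlled on one layer after the other. -/
def reach (D : ImmersedDomain d) : ℕ → Finset (Fin d → ℤ)
  | 0 => D.cells.filter fun c => c ∉ D.cutCells
  | n + 1 => D.reach n ∪ D.cutCells.filter fun c => ∃ c' ∈ D.reach n, ShareFace c c'

variable {D : ImmersedDomain d} {p : ℕ} {v : (Fin d → ℝ) → ℝ}

theorem mem_reach_zero {c : Fin d → ℤ} : c ∈ D.reach 0 ↔ c ∈ D.cells ∧ c ∉ D.cutCells := by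
  simp [reach]

theorem mem_reach_succ {n : ℕ} {c : Fin d → ℤ} :
    c ∈ D.reach (n + 1) ↔
      c ∈ D.reach n ∨ c ∈ D.cutCells ∧ ∃ c' ∈ D.reach n, ShareFace c c' := by
  simp [reach]

theorem reach_mono : Monotone D.reach :=
  monotone_nat_of_le_succ fun _ _ hc => mem_reach_succ.2 (.inl hc)

theorem reach_subset (n : ℕ) : D.reach n ⊆ D.cells := by
  induction n with
  | zero => exact fun c hc => (mem_reach_zero.1 hc).1
  | succ n ih =>
    exact fun c hc => (mem_reach_succ.1 hc).elim (fun h => ih h) fun h => cutCells_subset h.1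

theorem mem_reach_of_path (n : ℕ) (T : ℕ → Fin d → ℤ)
    (hT : ∀ i < n, T i ∈ D.cutCells ∧ ShareFace (T i) (T (i + 1))) (hn : T n ∈ D.cells)
    (hn' : T n ∉ D.cutCells) : T 0 ∈ D.reach n := by
  induction n generalizing T with
  | zero => exact mem_reach_zero.2 ⟨hn, hn'⟩
  | succ n ih =>
    have hone := ih (fun i => T (i + 1)) (fun i hi => hT (i + 1) (by lia)) hn hn'
    exact mem_reach_succ.2 (.inr ⟨(hT 0 n.succ_pos).1, _, hone, (hT 0 n.succ_pos).2⟩)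

theorem ResolvedWithin.reach_eq {N : ℕ} (hN : D.ResolvedWithin N) : D.reach N = D.cells := by
  refine (reach_subset N).antisymm fun c hc => ?_
  by_cases hcut : c ∈ D.cutCells
  · obtain ⟨n, hn, T, rfl, hT, hcell, hcut'⟩ := hN c hcut
    exact reach_mono hn (mem_reach_of_path n T hT hcell hcut')
  · exact reach_mono N.zero_le (mem_reach_zero.2 ⟨hc, hcut⟩)

end ImmersedDomain

end Reach

section StabilityBounds

theorem sum_sum_filter_le {α β : Type*} {S : Finset α} {T : Finset β} {R : α → β → Prop}
    [∀ a b, Decidable (R a b)] {m : ℕ} {f : β → ℝ} (hf : ∀ b ∈ T, 0 ≤ f b)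
    (hm : ∀ b ∈ T, (S.filter fun a => R a b).card ≤ m) :
    ∑ a ∈ S, ∑ b ∈ T with R a b, f b ≤ m * ∑ b ∈ T, f b := by
  calc ∑ a ∈ S, ∑ b ∈ T with R a b, f b
      = ∑ b ∈ T, ∑ a ∈ S with R a b, f b :=
        Finset.sum_sum_bipartiteAbove_eq_sum_sum_bipartiteBelow R fun _ b => f b
    _ ≤ ∑ b ∈ T, m * f b := Finset.sum_le_sum fun b hb => by
        rw [Finset.sum_const, nsmul_eq_mul]
        exact mul_le_mul_of_nonneg_right (mod_cast hm b hb) (hf b hb)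
    _ = m * ∑ b ∈ T, f b := (Finset.mul_sum _ _ _).symm

namespace ImmersedDomain

variable {d : ℕ} {D : ImmersedDomain d} {p : ℕ} {C : ℝ} {w : ℕ → ℝ} {v : (Fin d → ℝ) → ℝ}

/-- The cell `c` is one of the two cells adjacent to the face `F`, encoded as in `cutFaces`. -/
def IsSide (c : Fin d → ℤ) (F : (Fin d → ℤ) × Fin d) : Prop :=
  c = F.1 ∨ c = nextCell F.1 F.2

theorem card_filter_isSide_le (S : Finset (Fin d → ℤ)) (F : (Fin d → ℤ) × Fin d)
    [DecidablePred fun c => IsSide c F] : (S.filter fun c => IsSide c F).card ≤ 2 :=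
  (Finset.card_le_card fun c hc => by
    simpa [IsSide] using (Finset.mem_filter.1 hc).2).trans
    (Finset.card_le_two (a := F.1) (b := nextCell F.1 F.2))

theorem exists_cellEnergy_le (hC : 0 < C) (hN : IsNeighbourConst d p C)
    (hw : ∀ k ∈ Finset.Icc 1 p, 0 < w k) (hv : v ∈ D.feSpace p) {c c' : Fin d → ℤ}
    (hc : c ∈ D.cutCells) (hc' : c' ∈ D.cells) (hcc' : ShareFace c c') :
    ∃ F ∈ D.cutFaces, IsSide c F ∧
      D.cellEnergy v c ≤ weightL C p w * (D.cellEnergy v c' + D.faceEnergy p w v F) := by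
  have hcell := cutCells_subset hc
  obtain ⟨j, rfl | rfl⟩ := hcc'
  · exact ⟨(c, j), mem_cutFaces.2 ⟨hcell, hc', .inl hc⟩, .inl rfl,
      cellEnergy_le_nextCell hC hN hw hv hcell hc'⟩
  · exact ⟨(c', j), mem_cutFaces.2 ⟨hc', hcell, .inr hc⟩, .inr rfl,
      cellEnergy_nextCell_le hC hN hw hv hc' hcell⟩

open Classical in
theorem cellEnergy_le_of_mem_reach_succ (hC : 0 < C) (hN : IsNeighbourConst d p C)
    (hw : ∀ k ∈ Finset.Icc 1 p, 0 < w k) (hv : v ∈ D.feSpace p) {n : ℕ} {c : Fin d → ℤ}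
    (hc : c ∈ D.reach (n + 1) \ D.reach n) :
    D.cellEnergy v c ≤ weightL C p w *
      (∑ c' ∈ D.reach n with ShareFace c c', D.cellEnergy v c' +
        ∑ F ∈ D.cutFaces with IsSide c F, D.faceEnergy p w v F) := by
  rw [Finset.mem_sdiff, mem_reach_succ] at hc
  obtain ⟨hcut, c', hc', hcc'⟩ := hc.1.resolve_left hc.2
  obtain ⟨F, hF, hcF, hle⟩ := exists_cellEnergy_le hC hN hw hv hcut (reach_subset n hc') hcc'
  refine hle.trans (mul_le_mul_of_nonneg_left (add_le_add ?_ ?_) (hC.le.trans (le_weightL C hw)))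
  · exact Finset.single_le_sum (fun c _ => cellEnergy_nonneg v c)
      (Finset.mem_filter.2 ⟨hc', hcc'⟩)
  · exact Finset.single_le_sum (fun F _ => faceEnergy_nonneg hw v F)
      (Finset.mem_filter.2 ⟨hF, hcF⟩)

theorem stab_self (w : ℕ → ℝ) (v : (Fin d → ℝ) → ℝ) :
    D.stab p w v v = ∑ F ∈ D.cutFaces, D.faceEnergy p w v F :=
  rfl

theorem stab_self_nonneg (hw : ∀ k ∈ Finset.Icc 1 p, 0 < w k) (v : (Fin d → ℝ) → ℝ) :
    0 ≤ D.stab p w v v :=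
  Finset.sum_nonneg fun F _ => faceEnergy_nonneg hw v F

theorem sum_reach_succ_le (hC : 1 ≤ C) (hN : IsNeighbourConst d p C)
    (hw : ∀ k ∈ Finset.Icc 1 p, 0 < w k) (hv : v ∈ D.feSpace p) (n : ℕ) :
    ∑ c ∈ D.reach (n + 1), D.cellEnergy v c ≤ weightL C p w *
      ((2 * d + 1) * ∑ c ∈ D.reach n, D.cellEnergy v c + 2 * D.stab p w v v) := by
  classical
  have hL : 1 ≤ weightL C p w := hC.trans (le_weightL C hw)
  set E := ∑ c ∈ D.reach n, D.cellEnergy v c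
  have hE0 : 0 ≤ E := Finset.sum_nonneg fun c _ => cellEnergy_nonneg v c
  have hcells : ∑ c ∈ D.reach (n + 1) \ D.reach n, ∑ c' ∈ D.reach n with ShareFace c c',
      D.cellEnergy v c' ≤ (2 * d : ℕ) * E :=
    sum_sum_filter_le (fun c' _ => cellEnergy_nonneg v c') fun c' _ => card_filter_shareFace_le _ c'
  have hfaces : ∑ c ∈ D.reach (n + 1) \ D.reach n, ∑ F ∈ D.cutFaces with IsSide c F,
      D.faceEnergy p w v F ≤ (2 : ℕ) * D.stab p w v v :=
    sum_sum_filter_le (fun F _ => faceEnergy_nonneg hw v F) fun F _ => card_filter_isSide_le _ F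
  push_cast at hcells hfaces
  calc ∑ c ∈ D.reach (n + 1), D.cellEnergy v c
      = ∑ c ∈ D.reach (n + 1) \ D.reach n, D.cellEnergy v c + E :=
        (Finset.sum_sdiff (reach_mono n.le_succ)).symm
    _ ≤ weightL C p w * (2 * d * E + 2 * D.stab p w v v) + weightL C p w * E := by
        refine add_le_add ?_ (le_mul_of_one_le_left hE0 hL)
        refine (Finset.sum_le_sum fun c hc =>
          cellEnergy_le_of_mem_reach_succ (zero_lt_one.trans_le hC) hN hw hv hc).trans ?_
        rw [← Finset.mul_sum, Finset.sum_add_distrib]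
        gcongr
    _ = weightL C p w * ((2 * d + 1) * E + 2 * D.stab p w v v) := by ring

theorem sum_reach_zero_le (hv : v ∈ D.feSpace p) :
    ∑ c ∈ D.reach 0, D.cellEnergy v c ≤ l2Inner D.Ω v v := by
  rw [← l2Inner_biUnion_cell_self hv (reach_subset 0)]
  exact l2Inner_self_mono hv (Set.iUnion₂_subset fun c hc =>
    cell_subset_Ω (mem_reach_zero.1 hc).1 (mem_reach_zero.1 hc).2) D.Ω_subset

theorem sum_reach_le (hC : 1 ≤ C) (hN : IsNeighbourConst d p C)
    (hw : ∀ k ∈ Finset.Icc 1 p, 0 < w k) (hv : v ∈ D.feSpace p) (n : ℕ) :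
    ∑ c ∈ D.reach n, D.cellEnergy v c ≤
      ((2 * d + 3) * weightL C p w) ^ n * (l2Inner D.Ω v v + D.stab p w v v) := by
  have hL : 1 ≤ weightL C p w := hC.trans (le_weightL C hw)
  have hJ := stab_self_nonneg (D := D) hw v
  have hO := l2Inner_self_nonneg D.Ω v
  induction n with
  | zero => simpa using (sum_reach_zero_le hv).trans (le_add_of_nonneg_right hJ)
  | succ n ih =>
    set X := l2Inner D.Ω v v + D.stab p w v v
    have hX : D.stab p w v v ≤ X := le_add_of_nonneg_left hO
    have hK : 1 ≤ ((2 * d + 3) * weightL C p w) ^ n :=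
      one_le_pow₀ (one_le_mul_of_one_le_of_one_le (by linarith [Nat.cast_nonneg (α := ℝ) d]) hL)
    have hJX : D.stab p w v v ≤ ((2 * d + 3) * weightL C p w) ^ n * X :=
      hX.trans (le_mul_of_one_le_left (hJ.trans hX) hK)
    calc _ ≤ _ := sum_reach_succ_le hC hN hw hv n
      _ ≤ weightL C p w * ((2 * d + 1) * (((2 * d + 3) * weightL C p w) ^ n * X) +
          2 * (((2 * d + 3) * weightL C p w) ^ n * X)) := by gcongr
      _ = _ := by ring

theorem l2Inner_add_stab_self_le {γ : ℝ} (hγ : 0 < γ) (hw : ∀ k ∈ Finset.Icc 1 p, 0 < w k)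
    (v : (Fin d → ℝ) → ℝ) :
    l2Inner D.Ω v v + D.stab p w v v ≤ max 1 (1 / γ) * D.massForm p w γ v v := by
  rw [massForm, mul_add]
  refine add_le_add (le_mul_of_one_le_left (l2Inner_self_nonneg _ _) (le_max_left _ _)) ?_
  calc D.stab p w v v = 1 / γ * (γ * D.stab p w v v) := by field_simp
    _ ≤ _ := mul_le_mul_of_nonneg_right (le_max_right _ _)
      (mul_nonneg hγ.le (stab_self_nonneg hw v))

theorem l2Inner_meshDomain_le (hC : 1 ≤ C) (hN : IsNeighbourConst d p C)
    (hw : ∀ k ∈ Finset.Icc 1 p, 0 < w k) (hv : v ∈ D.feSpace p) {N : ℕ}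
    (hD : D.ResolvedWithin N) {γ : ℝ} (hγ : 0 < γ) :
    l2Inner D.meshDomain v v ≤
      (2 * d + 3) ^ N * max 1 (1 / γ) * weightL C p w ^ N * D.massForm p w γ v v := by
  have hL : 0 ≤ weightL C p w := zero_le_one.trans (hC.trans (le_weightL C hw))
  rw [l2Inner_meshDomain_self hv, ← hD.reach_eq]
  calc _ ≤ _ := sum_reach_le hC hN hw hv N
    _ ≤ ((2 * d + 3) * weightL C p w) ^ N * (max 1 (1 / γ) * D.massForm p w γ v v) := by
      gcongr
      exact l2Inner_add_stab_self_le hγ hw v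
    _ = _ := by rw [mul_pow]; ring

theorem sum_cutFaces_cellEnergy_le (v : (Fin d → ℝ) → ℝ) :
    ∑ F ∈ D.cutFaces, (D.cellEnergy v F.1 + D.cellEnergy v (nextCell F.1 F.2)) ≤
      2 * d * ∑ c ∈ D.cells, D.cellEnergy v c := by
  classical
  have hinj : Function.Injective
      fun F : (Fin d → ℤ) × Fin d => (nextCell F.1 F.2, F.2) := fun F F' hF => by
    obtain ⟨hcell, hj⟩ := Prod.mk.inj hF
    exact Prod.ext (nextCell_injective F.2 (by rwa [← hj] at hcell)) hj
  have hside : ∀ g : (Fin d → ℤ) × Fin d → (Fin d → ℤ) × Fin d, Function.Injective g →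
      (∀ F ∈ D.cutFaces, (g F).1 ∈ D.cells) →
      ∑ F ∈ D.cutFaces, D.cellEnergy v (g F).1 ≤ d * ∑ c ∈ D.cells, D.cellEnergy v c := by
    intro g hg hmem
    have hsub : D.cutFaces.image g ⊆ D.cells ×ˢ Finset.univ :=
      Finset.image_subset_iff.2 fun F hF => by simpa using hmem F hF
    calc ∑ F ∈ D.cutFaces, D.cellEnergy v (g F).1
        = ∑ F ∈ D.cutFaces.image g, D.cellEnergy v F.1 := by rw [Finset.sum_image hg.injOn]
      _ ≤ ∑ F ∈ D.cells ×ˢ Finset.univ, D.cellEnergy v F.1 :=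
        Finset.sum_le_sum_of_subset_of_nonneg hsub fun F _ _ => cellEnergy_nonneg v F.1
      _ = d * ∑ c ∈ D.cells, D.cellEnergy v c := by
        rw [Finset.sum_product]; simp [Finset.mul_sum]
  have hfst := hside id Function.injective_id fun F hF => (mem_cutFaces.1 hF).1
  have hsnd := hside _ hinj fun F hF => (mem_cutFaces.1 hF).2.1
  rw [Finset.sum_add_distrib]
  simp only [id_eq] at hfst
  linarith

theorem stab_self_le (hw : ∀ k ∈ Finset.Icc 1 p, 0 < w k) (hv : v ∈ D.feSpace p) :
    D.stab p w v v ≤ 144 * d * weightG p w * l2Inner D.meshDomain v v := by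
  have hG := weightG_nonneg hw
  rw [l2Inner_meshDomain_self hv, stab_self]
  calc _ ≤ ∑ F ∈ D.cutFaces, 72 * weightG p w *
        (D.cellEnergy v F.1 + D.cellEnergy v (nextCell F.1 F.2)) :=
        Finset.sum_le_sum fun F hF =>
          faceEnergy_le hw hv (mem_cutFaces.1 hF).1 (mem_cutFaces.1 hF).2.1
    _ ≤ 72 * weightG p w * (2 * d * ∑ c ∈ D.cells, D.cellEnergy v c) := by
        rw [← Finset.mul_sum]
        gcongr
        exact sum_cutFaces_cellEnergy_le v
    _ = _ := by ring

theorem massForm_self_le (hw : ∀ k ∈ Finset.Icc 1 p, 0 < w k) (hv : v ∈ D.feSpace p) {γ : ℝ}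
    (hγ : 0 ≤ γ) :
    D.massForm p w γ v v ≤ (1 + 144 * d * γ * weightG p w) * l2Inner D.meshDomain v v := by
  have hΩ : l2Inner D.Ω v v ≤ l2Inner D.meshDomain v v :=
    l2Inner_self_mono hv D.Ω_subset subset_rfl
  have hstab := mul_le_mul_of_nonneg_left (stab_self_le hw hv) hγ
  rw [massForm]
  linarith

end ImmersedDomain

end StabilityBounds

section Bilinearity

variable {d : ℕ}

theorem faceDeriv_add {o : Fin d → ℝ} {h : ℝ} {c : Fin d → ℤ} {j : Fin d} (k : ℕ)
    (q r : MvPolynomial (Fin d) ℝ) (y : {i : Fin d // i ≠ j} → ℝ) :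
    faceDeriv o h c j k (q + r) y = faceDeriv o h c j k q y + faceDeriv o h c j k r y := by
  simp [faceDeriv]

theorem faceDeriv_C_mul {o : Fin d → ℝ} {h : ℝ} {c : Fin d → ℤ} {j : Fin d} (k : ℕ) (a : ℝ)
    (q : MvPolynomial (Fin d) ℝ) (y : {i : Fin d // i ≠ j} → ℝ) :
    faceDeriv o h c j k (MvPolynomial.C a * q) y = a * faceDeriv o h c j k q y := by
  simp [faceDeriv, slice, Polynomial.iterate_derivative_C_mul]

/-- The bilinear form given by a symmetric function that is linear in its first argument; the two
scalar products on the finite element space are of this kind. -/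
def bilinOfSymm {R V : Type*} [CommSemiring R] [AddCommMonoid V] [Module R V] (f : V → V → R)
    (comm : ∀ u v, f u v = f v u) (add_left : ∀ u u' v, f (u + u') v = f u v + f u' v)
    (smul_left : ∀ (a : R) u v, f (a • u) v = a * f u v) : LinearMap.BilinForm R V :=
  LinearMap.mk₂ R f add_left smul_left (fun u v v' => by simp only [comm u, add_left])
    (fun a u v => by simp only [comm u, smul_left, smul_eq_mul])

theorem isSymm_bilinOfSymm {R V : Type*} [CommSemiring R] [AddCommMonoid V] [Module R V]
    {f : V → V → R} {comm : ∀ u v, f u v = f v u}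
    {add_left : ∀ u u' v, f (u + u') v = f u v + f u' v}
    {smul_left : ∀ (a : R) u v, f (a • u) v = a * f u v} :
    (bilinOfSymm f comm add_left smul_left).IsSymm :=
  ⟨comm⟩

namespace ImmersedDomain

variable {D : ImmersedDomain d} {p : ℕ} {u u' v : (Fin d → ℝ) → ℝ} {c : Fin d → ℤ} {j : Fin d}

theorem IsLocalPoly.add {q r : MvPolynomial (Fin d) ℝ} (hq : D.IsLocalPoly p u c q)
    (hr : D.IsLocalPoly p v c r) : D.IsLocalPoly p (u + v) c (q + r) where
  degreeOf_le i := (MvPolynomial.degreeOf_add_le i q r).trans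
    (max_le (hq.degreeOf_le i) (hr.degreeOf_le i))
  eq_eval x hx := by simp [hq.eq_eval x hx, hr.eq_eval x hx]

theorem IsLocalPoly.smul {q : MvPolynomial (Fin d) ℝ} (hq : D.IsLocalPoly p v c q) (a : ℝ) :
    D.IsLocalPoly p (a • v) c (MvPolynomial.C a * q) where
  degreeOf_le i := (MvPolynomial.degreeOf_C_mul_le q i a).trans (hq.degreeOf_le i)
  eq_eval x hx := by simp [hq.eq_eval x hx]

theorem jump_add (hu : u ∈ D.feSpace p) (hv : v ∈ D.feSpace p) (hc : c ∈ D.cells)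
    (hc' : nextCell c j ∈ D.cells) (k : ℕ) {y : {i : Fin d // i ≠ j} → ℝ}
    (hy : y ∈ faceBox D.o D.h c j) :
    D.jump c j k (u + v) (glue j (faceCoord D.o D.h c j) y) =
      D.jump c j k u (glue j (faceCoord D.o D.h c j) y) +
        D.jump c j k v (glue j (faceCoord D.o D.h c j) y) := by
  obtain ⟨q, hq⟩ := exists_isLocalPoly hu hc
  obtain ⟨q', hq'⟩ := exists_isLocalPoly hu hc'
  obtain ⟨r, hr⟩ := exists_isLocalPoly hv hc
  obtain ⟨r', hr'⟩ := exists_isLocalPoly hv hc'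
  rw [(hq.add hr).jump_glue (hq'.add hr') k hy, hq.jump_glue hq' k hy, hr.jump_glue hr' k hy,
    faceDeriv_add, faceDeriv_add]
  ring

theorem jump_smul (hv : v ∈ D.feSpace p) (hc : c ∈ D.cells) (hc' : nextCell c j ∈ D.cells)
    (k : ℕ) (a : ℝ) {y : {i : Fin d // i ≠ j} → ℝ} (hy : y ∈ faceBox D.o D.h c j) :
    D.jump c j k (a • v) (glue j (faceCoord D.o D.h c j) y) =
      a * D.jump c j k v (glue j (faceCoord D.o D.h c j) y) := by
  obtain ⟨q, hq⟩ := exists_isLocalPoly hv hc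
  obtain ⟨r, hr⟩ := exists_isLocalPoly hv hc'
  rw [(hq.smul a).jump_glue (hr.smul a) k hy, hq.jump_glue hr k hy, faceDeriv_C_mul,
    faceDeriv_C_mul, mul_sub]

theorem continuousOn_jump (hv : v ∈ D.feSpace p) (hc : c ∈ D.cells)
    (hc' : nextCell c j ∈ D.cells) (k : ℕ) :
    ContinuousOn (fun y => D.jump c j k v (glue j (faceCoord D.o D.h c j) y))
      (faceBox D.o D.h c j) := by
  obtain ⟨q, hq⟩ := exists_isLocalPoly hv hc
  obtain ⟨r, hr⟩ := exists_isLocalPoly hv hc'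
  exact ((continuous_faceDeriv k r).sub (continuous_faceDeriv k q)).continuousOn.congr
    fun y hy => hq.jump_glue hr k hy

theorem faceIntegral_jump_add (hu : u ∈ D.feSpace p) (hu' : u' ∈ D.feSpace p)
    (hv : v ∈ D.feSpace p) (hc : c ∈ D.cells) (hc' : nextCell c j ∈ D.cells) (k : ℕ) :
    D.faceIntegral c j (fun x => D.jump c j k (u + u') x * D.jump c j k v x) =
      D.faceIntegral c j (fun x => D.jump c j k u x * D.jump c j k v x) +
        D.faceIntegral c j (fun x => D.jump c j k u' x * D.jump c j k v x) := by
  have hint : ∀ {u}, u ∈ D.feSpace p → IntegrableOn (fun y =>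
      D.jump c j k u (glue j (faceCoord D.o D.h c j) y) *
        D.jump c j k v (glue j (faceCoord D.o D.h c j) y)) (faceBox D.o D.h c j) := fun hu =>
    ((continuousOn_jump hu hc hc' k).mul (continuousOn_jump hv hc hc' k)).integrableOn_compact
      (isCompact_faceBox _ _ _ _)
  simp only [faceIntegral_eq]
  rw [← integral_add (hint hu) (hint hu')]
  exact setIntegral_congr_fun (isCompact_faceBox _ _ _ _).measurableSet fun y hy => by
    simp only [jump_add hu hu' hc hc' k hy, add_mul]

theorem faceIntegral_jump_smul (hu : u ∈ D.feSpace p) (v : (Fin d → ℝ) → ℝ) (hc : c ∈ D.cells)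
    (hc' : nextCell c j ∈ D.cells) (k : ℕ) (a : ℝ) :
    D.faceIntegral c j (fun x => D.jump c j k (a • u) x * D.jump c j k v x) =
      a * D.faceIntegral c j (fun x => D.jump c j k u x * D.jump c j k v x) := by
  simp only [faceIntegral_eq]
  rw [← integral_const_mul]
  exact setIntegral_congr_fun (isCompact_faceBox _ _ _ _).measurableSet fun y hy => by
    simp only [jump_smul hu hc hc' k a hy, mul_assoc]

theorem stab_comm (w : ℕ → ℝ) (u v : (Fin d → ℝ) → ℝ) : D.stab p w u v = D.stab p w v u := by
  simp only [stab, mul_comm (D.jump _ _ _ u _)]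

theorem stab_add_left (w : ℕ → ℝ) (hu : u ∈ D.feSpace p) (hu' : u' ∈ D.feSpace p)
    (hv : v ∈ D.feSpace p) : D.stab p w (u + u') v = D.stab p w u v + D.stab p w u' v := by
  simp only [stab, ← Finset.sum_add_distrib]
  refine Finset.sum_congr rfl fun F hF => Finset.sum_congr rfl fun k _ => ?_
  obtain ⟨hc, hc', -⟩ := mem_cutFaces.1 hF
  rw [faceIntegral_jump_add hu hu' hv hc hc', mul_add]

theorem stab_smul_left (w : ℕ → ℝ) (a : ℝ) (hu : u ∈ D.feSpace p) (v : (Fin d → ℝ) → ℝ) :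
    D.stab p w (a • u) v = a * D.stab p w u v := by
  simp only [stab, Finset.mul_sum]
  refine Finset.sum_congr rfl fun F hF => Finset.sum_congr rfl fun k _ => ?_
  obtain ⟨hc, hc', -⟩ := mem_cutFaces.1 hF
  rw [faceIntegral_jump_smul hu v hc hc', mul_left_comm]

theorem l2Inner_comm (X : Set (Fin d → ℝ)) (u v : (Fin d → ℝ) → ℝ) :
    l2Inner X u v = l2Inner X v u := by
  simp only [l2Inner, mul_comm]

theorem l2Inner_add_left {X : Set (Fin d → ℝ)} (hX : X ⊆ D.meshDomain) (hu : u ∈ D.feSpace p)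
    (hu' : u' ∈ D.feSpace p) (hv : v ∈ D.feSpace p) :
    l2Inner X (u + u') v = l2Inner X u v + l2Inner X u' v := by
  simp only [l2Inner, Pi.add_apply, add_mul]
  exact integral_add (integrableOn_mul hu hv hX) (integrableOn_mul hu' hv hX)

theorem l2Inner_smul_left (X : Set (Fin d → ℝ)) (a : ℝ) (u v : (Fin d → ℝ) → ℝ) :
    l2Inner X (a • u) v = a * l2Inner X u v := by
  simp only [l2Inner, Pi.smul_apply, smul_eq_mul, mul_assoc, integral_const_mul]

variable (D)

/-- The `L²` scalar product over the background mesh, as a bilinear form on the finite element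
space: its Gram matrix is `meshMassMatrix`. -/
def meshBilin (p : ℕ) : LinearMap.BilinForm ℝ (D.feSpace p) :=
  bilinOfSymm (fun u v => l2Inner D.meshDomain u v) (fun u v => l2Inner_comm _ u.1 v.1)
    (fun u u' v => l2Inner_add_left subset_rfl u.2 u'.2 v.2)
    (fun a u v => l2Inner_smul_left _ a u.1 v.1)

/-- The stabilized form `massForm` as a bilinear form on the finite element space: its Gram matrix
is `massMatrix`. -/
def massBilin (p : ℕ) (w : ℕ → ℝ) (γ : ℝ) : LinearMap.BilinForm ℝ (D.feSpace p) :=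
  bilinOfSymm (fun u v => D.massForm p w γ u v)
    (fun u v => by simp only [massForm, l2Inner_comm _ u.1, stab_comm w u.1])
    (fun u u' v => by
      simp only [massForm, Submodule.coe_add, l2Inner_add_left D.Ω_subset u.2 u'.2 v.2,
        stab_add_left w u.2 u'.2 v.2]
      ring)
    (fun a u v => by
      simp only [massForm, Submodule.coe_smul, l2Inner_smul_left, stab_smul_left w a u.2 v.1]
      ring)

end ImmersedDomain

end Bilinearity

section Matrices

open Matrix

variable {ι : Type*} [Fintype ι] [DecidableEq ι]

theorem rayleighQuotient_toEuclideanCLM (A : Matrix ι ι ℝ) (x : EuclideanSpace ℝ ι) :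
    (toEuclideanCLM (n := ι) (𝕜 := ℝ) A).rayleighQuotient x = (x ⬝ᵥ A *ᵥ x) / ‖x‖ ^ 2 := by
  rw [ContinuousLinearMap.rayleighQuotient, ContinuousLinearMap.reApplyInnerSelf_apply,
    RCLike.re_to_real, real_inner_comm, inner_toEuclideanCLM]

theorem norm_toEuclideanCLM_le_mul {A B : Matrix ι ι ℝ} (hA : A.PosSemidef) {β : ℝ} (hβ : 0 ≤ β)
    (h : ∀ x : ι → ℝ, x ⬝ᵥ A *ᵥ x ≤ β * (x ⬝ᵥ B *ᵥ x)) :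
    ‖toEuclideanCLM (n := ι) (𝕜 := ℝ) A‖ ≤ β * ‖toEuclideanCLM (n := ι) (𝕜 := ℝ) B‖ := by
  rw [ContinuousLinearMap.norm_eq_iSup_rayleighQuotient _
    (isSymmetric_toEuclideanLin_iff.2 hA.isHermitian)]
  refine ciSup_le fun x => ?_
  have hnonneg := hA.dotProduct_mulVec_nonneg x
  rw [star_trivial] at hnonneg
  rw [rayleighQuotient_toEuclideanCLM, abs_of_nonneg (by positivity)]
  calc (x ⬝ᵥ A *ᵥ x) / ‖x‖ ^ 2 ≤ β * (x ⬝ᵥ B *ᵥ x) / ‖x‖ ^ 2 := by gcongr; exact h x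
    _ = β * (toEuclideanCLM (n := ι) (𝕜 := ℝ) B).rayleighQuotient x := by
      rw [rayleighQuotient_toEuclideanCLM, mul_div_assoc]
    _ ≤ β * ‖toEuclideanCLM (n := ι) (𝕜 := ℝ) B‖ := by
      gcongr
      exact (le_abs_self _).trans (ContinuousLinearMap.rayleighQuotient_le_norm _ x)

theorem dotProduct_inv_mulVec_le_mul {A B : Matrix ι ι ℝ} (hA : A.PosDef) (hB : B.PosDef) {K : ℝ}
    (hK : 0 < K) (h : ∀ x : ι → ℝ, x ⬝ᵥ B *ᵥ x ≤ K * (x ⬝ᵥ A *ᵥ x)) (x : ι → ℝ) :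
    x ⬝ᵥ A⁻¹ *ᵥ x ≤ K * (x ⬝ᵥ B⁻¹ *ᵥ x) := by
  have hmul_inv : ∀ {M : Matrix ι ι ℝ}, M.PosDef → M *ᵥ (M⁻¹ *ᵥ x) = x := fun {M} hM => by
    rw [mulVec_mulVec, mul_nonsing_inv _ ((isUnit_iff_isUnit_det M).1 hM.isUnit), one_mulVec]
  have hAz := hmul_inv hA
  have hBu := hmul_inv hB
  set z := A⁻¹ *ᵥ x
  set u := B⁻¹ *ᵥ x
  have hzz : z ⬝ᵥ B *ᵥ z ≤ K * (x ⬝ᵥ z) := by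
    simpa only [hAz, dotProduct_comm z x] using h z
  have huz : u ⬝ᵥ B *ᵥ z = x ⬝ᵥ z := by
    rw [dotProduct_mulVec, ← mulVec_transpose, ← conjTranspose_eq_transpose_of_trivial,
      hB.isHermitian.eq, hBu]
  have hsquare : 0 ≤ (K • u - z) ⬝ᵥ B *ᵥ (K • u - z) := by
    simpa only [star_trivial] using hB.posSemidef.dotProduct_mulVec_nonneg (K • u - z)
  simp only [mulVec_sub, mulVec_smul, sub_dotProduct, dotProduct_sub, smul_dotProduct,
    dotProduct_smul, smul_eq_mul, huz, hBu, dotProduct_comm _ x] at hsquare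
  refine le_of_mul_le_mul_left ?_ hK
  linarith

theorem condNumber_le_mul_condNumber {A B : Matrix ι ι ℝ} (hA : A.PosDef) (hB : B.PosDef)
    {K β : ℝ} (hK : 0 < K) (hβ : 0 ≤ β)
    (hBA : ∀ x : ι → ℝ, x ⬝ᵥ B *ᵥ x ≤ K * (x ⬝ᵥ A *ᵥ x))
    (hAB : ∀ x : ι → ℝ, x ⬝ᵥ A *ᵥ x ≤ β * (x ⬝ᵥ B *ᵥ x)) :
    condNumber A ≤ K * β * condNumber B := by
  have hnorm := norm_toEuclideanCLM_le_mul hA.posSemidef hβ hAB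
  have hnormInv := norm_toEuclideanCLM_le_mul hA.inv.posSemidef hK.le
    (dotProduct_inv_mulVec_le_mul hA hB hK hBA)
  calc condNumber A ≤ _ := mul_le_mul hnorm hnormInv (norm_nonneg _) (by positivity)
    _ = K * β * condNumber B := by rw [condNumber]; ring

theorem condNumber_toMatrix_le {V : Type*} [AddCommGroup V] [Module ℝ V]
    (b : Module.Basis ι ℝ V) {A B : LinearMap.BilinForm ℝ V} (hA : (A.toMatrix b).PosDef)
    (hB : (B.toMatrix b).PosDef) {K β : ℝ} (hK : 0 < K) (hβ : 0 ≤ β)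
    (hBA : ∀ v, B v v ≤ K * A v v) (hAB : ∀ v, A v v ≤ β * B v v) :
    condNumber (A.toMatrix b) ≤ K * β * condNumber (B.toMatrix b) := by
  refine condNumber_le_mul_condNumber hA hB hK hβ (fun x => ?_) fun x => ?_ <;>
    simp only [LinearMap.BilinForm.dotProduct_toMatrix_mulVec]
  exacts [hBA _, hAB _]

end Matrices

section MassMatrices

namespace ImmersedDomain

variable {d : ℕ} {D : ImmersedDomain d} {p : ℕ} {ι : Type*}

theorem massMatrix_eq_toMatrix [Fintype ι] [DecidableEq ι]
    (φ : Module.Basis ι ℝ (D.feSpace p)) (w : ℕ → ℝ) (γ : ℝ) :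
    D.massMatrix φ w γ = (D.massBilin p w γ).toMatrix φ := by
  ext i j
  rw [LinearMap.BilinForm.toMatrix_apply]
  rfl

theorem meshMassMatrix_eq_toMatrix [Fintype ι] [DecidableEq ι]
    (φ : Module.Basis ι ℝ (D.feSpace p)) :
    D.meshMassMatrix φ = (D.meshBilin p).toMatrix φ := by
  ext i j
  rw [LinearMap.BilinForm.toMatrix_apply]
  rfl

theorem posDef_meshMassMatrix [Finite ι] (φ : Module.Basis ι ℝ (D.feSpace p)) :
    (D.meshMassMatrix φ).PosDef := by
  classical
  have := Fintype.ofFinite ι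
  rw [meshMassMatrix_eq_toMatrix]
  exact (LinearMap.BilinForm.posDef_toQuadraticMap_iff_matrix φ _ isSymm_bilinOfSymm).1
    fun v hv => l2Inner_meshDomain_pos v.2 (Subtype.coe_ne_coe.2 hv)

theorem posDef_massMatrix [Finite ι] (φ : Module.Basis ι ℝ (D.feSpace p)) {w : ℕ → ℝ} {γ K : ℝ}
    (hK : 0 ≤ K) (h : ∀ v ∈ D.feSpace p, l2Inner D.meshDomain v v ≤ K * D.massForm p w γ v v) :
    (D.massMatrix φ w γ).PosDef := by
  classical
  have := Fintype.ofFinite ι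
  rw [massMatrix_eq_toMatrix]
  exact (LinearMap.BilinForm.posDef_toQuadraticMap_iff_matrix φ _ isSymm_bilinOfSymm).1
    fun v hv => pos_of_mul_pos_right
      ((l2Inner_meshDomain_pos v.2 (Subtype.coe_ne_coe.2 hv)).trans_le (h v v.2)) hK

end ImmersedDomain

end MassMatrices

end CutFEM

end

theorem lemma4 (d : ℕ) (hd : 1 ≤ d) :
    (∀ p : ℕ, ∃ C₁ : ℝ, CutFEM.IsNeighbourConst d p C₁) ∧
    ∀ γ : ℝ, 0 < γ → ∃ Cg : ℝ, 0 < Cg ∧ ∀ NJ : ℕ, ∃ Cl : ℝ, 0 < Cl ∧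
      ∀ p : ℕ, 1 ≤ p → ∀ C₁ : ℝ, CutFEM.IsNeighbourConst d p C₁ →
      ∀ w : ℕ → ℝ, (∀ k ∈ Finset.Icc 1 p, 0 < w k) →
      ∀ D : CutFEM.ImmersedDomain d, D.ResolvedWithin NJ →
      ∀ (ι : Type) [Fintype ι] [DecidableEq ι] (φ : Module.Basis ι ℝ (D.feSpace p)),
        (D.massMatrix φ w γ).PosDef ∧ (D.meshMassMatrix φ).PosDef ∧
        CutFEM.condNumber (D.massMatrix φ w γ) ≤
          Cl * CutFEM.weightL C₁ p w ^ NJ * (1 + Cg * CutFEM.weightG p w) *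
            CutFEM.condNumber (D.meshMassMatrix φ) := by
  have : (0 : ℝ) < d := mod_cast hd
  refine ⟨CutFEM.exists_isNeighbourConst d, fun γ hγ => ⟨144 * d * γ, by positivity, fun N =>
    ⟨(2 * d + 3) ^ N * max 1 (1 / γ), by positivity, fun p _ C hC w hw D hD ι _ _ φ => ?_⟩⟩⟩
  have hC1 : 1 ≤ C := hC.one_le hd
  have hL : 0 < CutFEM.weightL C p w :=
    zero_lt_one.trans_le (hC1.trans (CutFEM.le_weightL C hw))
  have hG : 0 ≤ CutFEM.weightG p w := CutFEM.weightG_nonneg hw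
  have hK : 0 < (2 * d + 3) ^ N * max 1 (1 / γ) * CutFEM.weightL C p w ^ N := by positivity
  have hlower : ∀ v ∈ D.feSpace p, CutFEM.ImmersedDomain.l2Inner D.meshDomain v v ≤
      (2 * d + 3) ^ N * max 1 (1 / γ) * CutFEM.weightL C p w ^ N * D.massForm p w γ v v :=
    fun v hv => CutFEM.ImmersedDomain.l2Inner_meshDomain_le hC1 hC hw hv hD hγ
  have hupper : ∀ v ∈ D.feSpace p, D.massForm p w γ v v ≤
      (1 + 144 * d * γ * CutFEM.weightG p w) *
        CutFEM.ImmersedDomain.l2Inner D.meshDomain v v :=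
    fun v hv => CutFEM.ImmersedDomain.massForm_self_le hw hv hγ.le
  have hmass := CutFEM.ImmersedDomain.posDef_massMatrix φ hK.le hlower
  have hmesh := CutFEM.ImmersedDomain.posDef_meshMassMatrix φ
  refine ⟨hmass, hmesh, ?_⟩
  rw [CutFEM.ImmersedDomain.massMatrix_eq_toMatrix] at hmass ⊢
  rw [CutFEM.ImmersedDomain.meshMassMatrix_eq_toMatrix] at hmesh ⊢
  exact CutFEM.condNumber_toMatrix_le φ hmass hmesh hK (by positivity)
    (fun v => hlower v v.2) fun v => hupper v v.2
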